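/- **Setting.** Let $\mathbb K$ be a field of characteristic $0$ and $\mathcal H=\bigoplus_{n\ge 0}\mathcal H^{(n)}$ a connected graded commutative $\mathbb K$-bialgebra (hence a Hopf algebra) with coproduct $\Delta$ and counit $\epsilon$, for instance the Connes–Kreimer Hopf algebra $\mathcal H_{\mathcal F}$ of Feynman graphs, graded by loop number. Let $A$ be a commutative unital $\mathbb K$-algebra and $R:A\to A$ an idempotent linear map with $R(x)R(y)=R\big(R(x)y+xR(y)-xy\big)$ for all $x,y$ (a Rota–Baxter map of weight one); put $\tilde R=\mathrm{id}-R$. Let $\mathcal A=\mathrm{Hom}(\mathcal H,A)$ with the convolution product $\star$, unit $e_A=\eta_A\circ\epsilon$, filtration $\mathcal A_n=\{f: f(\mathcal H^{(k)})=0 \text{ for } k\le n-1\}$ and operators $\mathcal R(f)=R\circ f$, $\tilde{\mathcal R}=\mathrm{id}-\mathcal R$. Limits in $\mathcal A$ are taken in the topology of the filtration; $\exp^\star$ and $\log^\star$ are the usual power series for $\star$ on $\mathcal A_1$ and $e_A+\mathcal A_1$; $\mathrm{BCH}(x,y)=\log^\star(\exp^\star(x)\star\exp^\star(y))-x-y$;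 for $u\in\mathcal A_1$, $\chi(u)=\lim_n\chi_{(n)}(u)$ with $\chi_{(0)}(u)=u$ and $\chi_{(n+1)}(u)=u-\mathrm{BCH}\big(\mathcal R(\chi_{(n)}(u)),\tilde{\mathcal R}(\chi_{(n)}(u))\big)$. Characters are unital algebra morphisms $\mathcal H\to A$. The double product is $f\star_{\mathcal R}g=\mathcal R(f)\star g+f\star\mathcal R(g)-f\star g$, and $\exp^{\star_{\mathcal R}}(f)=e_A+\sum_{n\ge1}f^{\star_{\mathcal R}n}/n!$. For $\Gamma\in\mathcal H$ write $\Delta(\Gamma)=\Gamma\otimes1+1\otimes\Gamma+\sum\Gamma'\otimes\Gamma''$ (for a one-particle irreducible Feynman graph, $\sum\Gamma'\otimes\Gamma''=\sum_{\gamma\subset\Gamma}\gamma\otimes\Gamma/\gamma$). **Theorem.** $(\mathcal A,\mathcal R)$ with the filtration $(\mathcal A_n)$ is a complete filtered Rota–Baxter algebra of weight one with idempotent, filtration preserving Rota–Baxter map. Let $\phi$ be an $A$-valued character, $a=\phi-e_A$ and $b=\log^\star(\phi)$. Then $a\in\mathcal A_1$, $\phi$ is $\star$-invertible, $b$ is an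 infinitesimal character and the unique element of $\mathcal A_1$ with $\exp^\star(b)=\phi$, and the recursion converges to an element $\chi(b)\in\mathcal A_1$ with $\chi(b)=b-\mathrm{BCH}\big(\mathcal R(\chi(b)),\tilde{\mathcal R}(\chi(b))\big)$. Moreover: 1. Each of the equations $X=e_A-\mathcal R(X\star a)$ and $Y=e_A-\tilde{\mathcal R}(a\star Y)$ has a unique solution in $\mathcal A$; with $\phi_-:=X$, $Y$ is an invertible character and with $\phi_+:=Y^{-1}$ one has $\phi_+=\phi_-\star\phi$ and $\phi_+=e_A-\tilde{\mathcal R}\big(\phi_+\star(\phi^{-1}-e_A)\big)$. For $\Gamma\in\ker\epsilon$, $$\phi_-(\Gamma)=-R\Big(\phi(\Gamma)+\sum\phi_-(\Gamma')\phi(\Gamma'')\Big),\qquad \phi_+(\Gamma)=\tilde R\Big(\phi(\Gamma)+\sum\phi_-(\Gamma')\phi(\Gamma'')\Big).$$ 2. $\phi_-=\sum_{n\ge0}(-1)^n\,\mathcal R(\mathcal R(\cdots\mathcal R(a)\star a\cdots)\star a)$ and $\phi_+^{-1}=\sum_{n\ge0}(-1)^n\,\tilde{\mathcal R}(a\star\tilde{\mathcal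 R}(a\star\cdots\tilde{\mathcal R}(a)\cdots))$ ($n$ factors $a$ in the $n$-th term), and $$\phi_-=\exp^\star\big(-\mathcal R(\chi(b))\big),\qquad \phi_+=\exp^\star\big(\tilde{\mathcal R}(\chi(b))\big).$$ Both $\phi_-$ and $\phi_+$ are characters, $\phi_-\in e_A+\mathcal R(\mathcal A_1)$ and $\phi_+\in e_A+\tilde{\mathcal R}(\mathcal A_1)$. 3. $\phi=\exp^\star\big(\mathcal R(\chi(b))\big)\star\exp^\star\big(\tilde{\mathcal R}(\chi(b))\big)=\phi_-^{-1}\star\phi_+$, and $(\phi_-,\phi_+)$ is the only pair $(\psi_-,\psi_+)$ with $\psi_-\in e_A+\mathcal R(\mathcal A_1)$, $\psi_+\in e_A+\tilde{\mathcal R}(\mathcal A_1)$ and $\phi=\psi_-^{-1}\star\psi_+$. 4. Bogoliubov's map $\bar{\mathrm R}[\phi](\Gamma):=\phi(\Gamma)+\sum\phi_-(\Gamma')\phi(\Gamma'')$ satisfies $\bar{\mathrm R}[\phi]=\phi_-\star(\phi-e_A)=e_A-\exp^{\star_{\mathcal R}}\big(-\chi(\log^\star\phi)\big)$; in particular $\bar{\mathrm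 R}[\phi]=-\exp^{\star_{\mathcal R}}\big(-\chi(\log^\star\phi)\big)$ on $\ker\epsilon$. Furthermore $\mathcal R(\bar{\mathrm R}[\phi])=e_A-\phi_-$ and $\tilde{\mathcal R}(\bar{\mathrm R}[\phi])=\phi_+-e_A$. With $E=\exp^{\star_{\mathcal R}}\big(-\chi(\log^\star\phi)\big)$, the equalities $\mathcal R(E)=\phi_--e_A$ and $\tilde{\mathcal R}(E)=2e_A-\phi_+$ hold on $\ker\epsilon$, and on all of $\mathcal H$ if $R(1_A)=0$. -/

import Mathlib

open scoped TensorProduct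

noncomputable section

namespace RotaBaxterRenorm

/-! ### Complete filtered algebras, exponential, logarithm, BCH-recursion -/

section Filtered

variable {K B : Type*} [Field K] [Ring B] [Algebra K B]

/-- A decreasing algebra filtration `F 0 ⊇ F 1 ⊇ …` exhausting `B`
(for a decreasing filtration this means `F 0 = B`), which is separated and complete. -/
structure IsCompleteFiltered (F : ℕ → Submodule K B) : Prop where
  zero_eq_top : F 0 = ⊤
  antitone : ∀ n, F (n + 1) ≤ F n
  mul_mem : ∀ m n x y, x ∈ F m → y ∈ F n → x * y ∈ F (m + n)
  separated : ∀ x, (∀ n, x ∈ F n) → x = 0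
  complete : ∀ u : ℕ → B, (∀ n, ∃ N, ∀ p ≥ N, ∀ q ≥ N, u p - u q ∈ F n) →
    ∃ L, ∀ n, ∃ N, ∀ p ≥ N, u p - L ∈ F n

/-- `L` is a limit of the sequence `u` in the topology given by the filtration. -/
def IsFilLimit (F : ℕ → Submodule K B) (u : ℕ → B) (L : B) : Prop :=
  ∀ n, ∃ N, ∀ p ≥ N, u p - L ∈ F n

open Classical in
/-- The limit of `u` in the topology given by the filtration (`0` if there is none). -/
def filLim (F : ℕ → Submodule K B) (u : ℕ → B) : B :=
  if h : ∃ L, IsFilLimit F u L then h.choose else 0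

/-- `exp a = ∑_{n ≥ 0} a ^ n / n!`. -/
def filExp (F : ℕ → Submodule K B) (a : B) : B :=
  filLim F fun N => ∑ n ∈ Finset.range N, ((n.factorial : K)⁻¹) • a ^ n

/-- `log y = - ∑_{n ≥ 1} (-(y - 1)) ^ n / n`. -/
def filLog (F : ℕ → Submodule K B) (y : B) : B :=
  filLim F fun N => -∑ n ∈ Finset.range N, (((n + 1 : ℕ) : K)⁻¹) • (-(y - 1)) ^ (n + 1)

/-- `BCH(x, y)`, determined by `exp x * exp y = exp (x + y + BCH(x, y))`. -/
def filBCH (F : ℕ → Submodule K B) (x y : B) : B :=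
  filLog F (filExp F x * filExp F y) - x - y

/-- The approximations of the BCH-recursion of a linear map `P`:
`χ₀(a) = a`, `χₙ₊₁(a) = a - BCH(P(χₙ(a)), (id - P)(χₙ(a)))`. -/
def chiApprox (F : ℕ → Submodule K B) (P : B →ₗ[K] B) (a : B) : ℕ → B
  | 0 => a
  | n + 1 => a - filBCH F (P (chiApprox F P a n)) (chiApprox F P a n - P (chiApprox F P a n))

/-- The BCH-recursion `χ(a) = lim χₙ(a)`. -/
def chi (F : ℕ → Submodule K B) (P : B →ₗ[K] B) (a : B) : B :=
  filLim F (chiApprox F P a)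

/-- The Rota–Baxter relation of weight `θ`. -/
def IsRotaBaxter (θ : K) (R : B →ₗ[K] B) : Prop :=
  ∀ x y, R x * R y = R (R x * y + x * R y - θ • (x * y))

/-- A complete filtered algebra with a filtration preserving Rota–Baxter map of weight `θ`. -/
structure IsCompleteFilteredRotaBaxter (θ : K) (F : ℕ → Submodule K B) (R : B →ₗ[K] B) :
    Prop where
  completeFiltered : IsCompleteFiltered F
  rotaBaxter : IsRotaBaxter θ R
  map_mem : ∀ n x, x ∈ F n → R x ∈ F n

/-- The double Rota–Baxter product (weight one). -/
def doubleMul (R : B →ₗ[K] B) (x y : B) : B := R x * y + x * R y - x * y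

/-- `doublePow R x n` is the `(n + 1)`-st power of `x` for the double product. -/
def doublePow (R : B →ₗ[K] B) (x : B) : ℕ → B
  | 0 => x
  | n + 1 => doubleMul R (doublePow R x n) x

/-- The exponential for the double product, with the unit of `B` as term of order zero:
`1 + ∑_{n ≥ 1} x ^ {*_R n} / n!`. -/
def doubleExp (F : ℕ → Submodule K B) (R : B →ₗ[K] B) (x : B) : B :=
  1 + filLim F fun N => ∑ n ∈ Finset.range N, (((n + 1).factorial : K)⁻¹) • doublePow R x n

/-- `leftIter R a n = R(R(⋯R(R(a) a)⋯ a) a)` with `n` occurrences of `a`. -/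
def leftIter (R : B →ₗ[K] B) (a : B) : ℕ → B
  | 0 => 1
  | n + 1 => R (leftIter R a n * a)

/-- `rightIter R a n = R(a R(a ⋯ R(a R(a))⋯))` with `n` occurrences of `a`. -/
def rightIter (R : B →ₗ[K] B) (a : B) : ℕ → B
  | 0 => 1
  | n + 1 => R (a * rightIter R a n)

/-- The set `1 + R(F 1)`. -/
def oneAddRange (F : ℕ → Submodule K B) (R : B →ₗ[K] B) : Set B :=
  {y | ∃ u ∈ F 1, y = 1 + R u}

end Filtered

/-! ### Connected graded bialgebras and their convolution algebras -/

section Hopf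

variable {K H A : Type*} [Field K] [CommRing H] [Bialgebra K H] [CommRing A] [Algebra K A]

/-- The algebra grading `G` makes `H` a connected graded bialgebra:
`Δ(G n) ⊆ ⨁_{p + q = n} G p ⊗ G q` and `G 0 = K · 1`. -/
structure IsConnectedGradedBialgebra (G : ℕ → Submodule K H) [GradedAlgebra G] : Prop where
  comul_mem : ∀ n, ∀ x ∈ G n, (Coalgebra.comul x : H ⊗[K] H) ∈
    ⨆ pq ∈ Finset.HasAntidiagonal.antidiagonal n, LinearMap.range (TensorProduct.mapIncl (G pq.1) (G pq.2))
  connected : G 0 = 1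

variable (K H A) in
/-- `Hom(H, A)`, with the convolution product and the unit `η_A ∘ ε`. -/
abbrev ConvHom := WithConv (H →ₗ[K] A)

variable (A) in
/-- `Hom(H, A)_n`: the maps that vanish in all degrees `k ≤ n - 1`. -/
def homFil (G : ℕ → Submodule K H) (n : ℕ) : Submodule K (ConvHom K H A) where
  carrier := {f | ∀ k < n, ∀ x ∈ G k, f x = 0}
  add_mem' {f g} hf hg k hk x hx := by
    change f x + g x = 0
    rw [hf k hk x hx, hg k hk x hx, add_zero]
  zero_mem' _ _ _ _ := rfl
  smul_mem' c f hf k hk x hx := by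
    change c • f x = 0
    rw [hf k hk x hx, smul_zero]

variable (H) in
/-- The operator `f ↦ R ∘ f` on `Hom(H, A)`. -/
def postComp (R : A →ₗ[K] A) : ConvHom K H A →ₗ[K] ConvHom K H A where
  toFun f := WithConv.toConv (R ∘ₗ f.ofConv)
  map_add' f g := by ext x; exact map_add R _ _
  map_smul' c f := by ext x; exact map_smul R _ _

/-- `A`-valued characters: (unital) algebra morphisms. -/
def IsCharacter (f : ConvHom K H A) : Prop :=
  f 1 = 1 ∧ ∀ x y, f (x * y) = f x * f y

/-- `A`-valued infinitesimal characters. -/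
def IsInfinitesimalCharacter (Z : ConvHom K H A) : Prop :=
  ∀ x y, Z (x * y) = algebraMap K A (Coalgebra.counit x) * Z y
    + Z x * algebraMap K A (Coalgebra.counit y)

variable (K H) in
/-- The reduced coproduct `x ↦ Δ(x) - x ⊗ 1 - 1 ⊗ x`. -/
def reducedComul : H →ₗ[K] H ⊗[K] H :=
  Coalgebra.comul - (TensorProduct.mk K H H).flip 1 - TensorProduct.mk K H H 1

/-- Bogoliubov's preparation map `Γ ↦ φ(Γ) + ∑ ψ(Γ') φ(Γ'')` of `φ` with counterterm `ψ`, the sum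
being over the reduced coproduct `∑ Γ' ⊗ Γ''` of `Γ`. -/
def barMap (ψ φ : ConvHom K H A) : ConvHom K H A :=
  WithConv.toConv (φ.ofConv +
    LinearMap.mul' K A ∘ₗ TensorProduct.map ψ.ofConv φ.ofConv ∘ₗ reducedComul K H)

end Hopf

end RotaBaxterRenorm

end

/-!
Every equation of the theorem is solved by a contraction: a map improving congruences modulo the
filtration has one fixed point, the limit of its iterates. This covers the recursions for `φ₋` and
`φ₊⁻¹`, the recursion for `χ`, and the injectivity of `exp`.

The fixed point equation of `c = χ(log φ)` says exactly that `φ = exp (R c) * exp (c - R c)`, so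
`φ₋ = exp (-R c)` and `φ₊ = exp (c - R c)` factorise `φ`. Both `R` and `R - id` turn the double
product into the given product, and therefore the double exponential `E = exp^{*_R} x` into the
exponential: `R (E - 1) = exp (R x) - 1` and `(R - id) (E - 1) = exp (R x - x) - 1`. Subtracting
gives `E - 1 = exp (R x) - exp (R x - x)`, which for `x = -c` is `φ₋ * (1 - φ)` and for `x = c` is
`(φ - 1) * φ₊⁻¹`; applying `R` and `id - R` then yields both recursions.

In a convolution algebra, `f` is multiplicative when its pullback along the multiplication of
`H` is the product of its pullbacks along `id ⊗ ε` and `ε ⊗ id`, and an infinitesimal character when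
it is their sum. As the latter two pullbacks commute, `exp` matches the two notions, so `log φ`,
then every approximation of `c`, and finally `c` and `R c` are infinitesimal characters.
-/

noncomputable section

namespace RotaBaxterRenorm

/-! ### The formal identity `exp (log (1 + X)) = 1 + X` -/

section Formal

open PowerSeries

variable (K : Type*) [CommRing K] [Algebra ℚ K]

theorem one_add_X_mul_derivative_log : (1 + X) * d⁄dX K (PowerSeries.log K) = 1 := by
  rw [deriv_log]
  ext n
  cases n with
  | zero => simp [add_mul]
  | succ n => simp [add_mul, coeff_succ_X_mul, coeff_one, pow_succ]

variable {K} in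
theorem eq_one_add_X_of_mul_derivative_eq {f : PowerSeries K} (hf : (1 + X) * d⁄dX K f = f)
    (h0 : constantCoeff f = 1) : f = 1 + X := by
  have : IsAddTorsionFree K := .of_module_rat K
  have hunit : IsUnit (1 + X : PowerSeries K) := isUnit_iff_constantCoeff.2 (by simp)
  have h2 : (1 + X : PowerSeries K) * d⁄dX K (d⁄dX K f) = 0 := by
    have := congrArg (d⁄dX K) hf
    simp only [Derivation.leibniz, map_add, Derivation.map_one_eq_zero, derivative_X, zero_add,
      smul_eq_mul, mul_one, add_eq_right] at this
    exact this
  have h1 : d⁄dX K f = 1 := by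
    refine derivative.ext ?_ ?_
    · rw [hunit.mul_right_eq_zero.1 h2, Derivation.map_one_eq_zero]
    · simpa [h0] using congrArg constantCoeff hf
  rw [← hf, h1, mul_one]

theorem exp_subst_log : (PowerSeries.exp K).subst (PowerSeries.log K) = 1 + X := by
  refine eq_one_add_X_of_mul_derivative_eq ?_ ?_
  · rw [derivative_subst HasSubst.log, derivative_exp, mul_left_comm,
      one_add_X_mul_derivative_log, mul_one]
  · rw [← coeff_zero_eq_constantCoeff_apply, coeff_subst' HasSubst.log,
      finsum_eq_single _ 0 fun d hd => by simp [hd]]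
    simp

end Formal

/-! ### Limits, contractions and series in complete filtered algebras -/

section Filtration

variable {K B B' : Type*} [Field K] [Ring B] [Algebra K B] [Ring B'] [Algebra K B']
  {F : ℕ → Submodule K B} {F' : ℕ → Submodule K B'}

/-- A self-map of `F m` that improves congruences: elements congruent modulo `F n` have images
congruent modulo `F (n + 1)`. -/
structure IsFilContraction (F : ℕ → Submodule K B) (m : ℕ) (T : B → B) : Prop where
  mapsTo : Set.MapsTo T (F m) (F m)
  sub_mem : ∀ ⦃n x y⦄, x ∈ F m → y ∈ F m → x - y ∈ F n → T x - T y ∈ F (n + 1)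

/-- The sum `∑ uₙ` of a series in the topology given by the filtration. -/
def filSum (F : ℕ → Submodule K B) (u : ℕ → B) : B :=
  filLim F fun N => ∑ n ∈ Finset.range N, u n

namespace IsCompleteFiltered

variable (hF : IsCompleteFiltered F)
include hF

theorem le_of_le {m n : ℕ} (h : m ≤ n) : F n ≤ F m := antitone_nat_of_succ_le hF.antitone h

theorem mem_zero (x : B) : x ∈ F 0 := by rw [hF.zero_eq_top]; trivial

theorem mul_mem_left {n : ℕ} (x : B) {y : B} (hy : y ∈ F n) : x * y ∈ F n := by
  simpa using hF.mul_mem 0 n x y (hF.mem_zero x) hy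

theorem mul_mem_right {n : ℕ} {x : B} (y : B) (hx : x ∈ F n) : x * y ∈ F n := by
  simpa using hF.mul_mem n 0 x y hx (hF.mem_zero y)

theorem mul_sub_one_mem {x y : B} (hx : x - 1 ∈ F 1) (hy : y - 1 ∈ F 1) : x * y - 1 ∈ F 1 := by
  rw [show x * y - 1 = (x - 1) * y + (y - 1) by noncomm_ring]
  exact (F 1).add_mem (hF.mul_mem_right y hx) hy

theorem pow_mem {x : B} (hx : x ∈ F 1) (n : ℕ) : x ^ n ∈ F n := by
  induction n with
  | zero => exact hF.mem_zero _
  | succ n ih => rw [pow_succ]; exact hF.mul_mem n 1 _ _ ih hx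

theorem pow_sub_pow_mem {x y : B} (hx : x ∈ F 1) (hy : y ∈ F 1) {n : ℕ} (h : x - y ∈ F n)
    (k : ℕ) : x ^ (k + 1) - y ^ (k + 1) ∈ F (n + k) := by
  induction k with
  | zero => simpa using h
  | succ k ih =>
    rw [pow_succ, pow_succ y, show x ^ (k + 1) * x - y ^ (k + 1) * y
      = (x ^ (k + 1) - y ^ (k + 1)) * x + y ^ (k + 1) * (x - y) by noncomm_ring]
    refine (F _).add_mem (hF.mul_mem (n + k) 1 _ _ ih hx) ?_
    rw [add_comm n (k + 1)]
    exact hF.mul_mem _ _ _ _ (hF.pow_mem hy _) h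

theorem eq_of_sub_mem {x y : B} (h : ∀ n, x - y ∈ F n) : x = y :=
  sub_eq_zero.1 (hF.separated _ h)

theorem isFilLimit_of_sub_mem {u : ℕ → B} {L : B} (h : ∀ n, u n - L ∈ F n) : IsFilLimit F u L :=
  fun n => ⟨n, fun p hp => hF.le_of_le hp (h p)⟩

theorem isFilLimit_unique {u : ℕ → B} {L M : B} (hL : IsFilLimit F u L)
    (hM : IsFilLimit F u M) : L = M := by
  refine hF.eq_of_sub_mem fun n => ?_
  obtain ⟨N, hN⟩ := hL n
  obtain ⟨N', hN'⟩ := hM n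
  simpa using (F n).sub_mem (hN' _ (le_max_right N N')) (hN _ (le_max_left N N'))

theorem filLim_eq {u : ℕ → B} {L : B} (hL : IsFilLimit F u L) : filLim F u = L := by
  have h : ∃ L, IsFilLimit F u L := ⟨L, hL⟩
  rw [filLim, dif_pos h]
  exact hF.isFilLimit_unique h.choose_spec hL

theorem sub_filLim_mem {u : ℕ → B} (h : ∀ n, u (n + 1) - u n ∈ F n) (n : ℕ) :
    u n - filLim F u ∈ F n := by
  have hcauchy : ∀ n p, n ≤ p → u p - u n ∈ F n := by
    intro n p hp
    induction p, hp using Nat.le_induction with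
    | base => simp
    | succ p hp ih =>
      rw [← sub_add_sub_cancel _ (u p)]
      exact (F n).add_mem (hF.le_of_le hp (h p)) ih
  obtain ⟨L, hL⟩ := hF.complete u fun n => ⟨n, fun p hp q hq => by
    simpa using (F n).sub_mem (hcauchy n p hp) (hcauchy n q hq)⟩
  obtain ⟨N, hN⟩ := hL n
  rw [hF.filLim_eq hL]
  simpa using (F n).sub_mem (hN (max n N) (le_max_right n N)) (hcauchy n _ (le_max_left n N))

theorem sum_range_sub_filSum_mem {u : ℕ → B} (hu : ∀ n, u n ∈ F n) (N : ℕ) :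
    ∑ n ∈ Finset.range N, u n - filSum F u ∈ F N :=
  hF.sub_filLim_mem (u := fun N => ∑ n ∈ Finset.range N, u n)
    (fun n => by simpa [Finset.sum_range_succ] using hu n) N

theorem filSum_eq {u : ℕ → B} {L : B} (h : ∀ N, ∑ n ∈ Finset.range N, u n - L ∈ F N) :
    filSum F u = L :=
  hF.filLim_eq (hF.isFilLimit_of_sub_mem h)

theorem filSum_eq_zero_add {u : ℕ → B} (hu : ∀ n, u n ∈ F n) :
    filSum F u = u 0 + filSum F fun n => u (n + 1) := by
  rw [← sub_eq_iff_eq_add']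
  refine (hF.filSum_eq fun N => ?_).symm
  have := hF.antitone N (hF.sum_range_sub_filSum_mem hu (N + 1))
  rwa [Finset.sum_range_succ', ← sub_sub_eq_add_sub] at this

theorem filSum_eq_single {u : ℕ → B} (hu : ∀ n, u n ∈ F n) (k : ℕ) (h : ∀ n, n ≠ k → u n = 0) :
    filSum F u = u k := by
  refine hF.filSum_eq fun N => ?_
  rcases lt_or_ge k N with hk | hk
  · simp [Finset.sum_eq_single_of_mem k (Finset.mem_range.2 hk) fun n _ => h n]
  · rw [Finset.sum_eq_zero fun n hn => h n (by have := Finset.mem_range.1 hn; lia), zero_sub]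
    exact (F N).neg_mem (hF.le_of_le hk (hu k))

theorem filSum_add {u v : ℕ → B} (hu : ∀ n, u n ∈ F n) (hv : ∀ n, v n ∈ F n) :
    filSum F (fun n => u n + v n) = filSum F u + filSum F v := by
  refine hF.filSum_eq fun N => ?_
  rw [Finset.sum_add_distrib, add_sub_add_comm]
  exact (F N).add_mem (hF.sum_range_sub_filSum_mem hu N) (hF.sum_range_sub_filSum_mem hv N)

theorem map_filSum (hF' : IsCompleteFiltered F') {T : B →ₗ[K] B'}
    (hT : ∀ n x, x ∈ F n → T x ∈ F' n) {u : ℕ → B} (hu : ∀ n, u n ∈ F n) :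
    T (filSum F u) = filSum F' fun n => T (u n) := by
  refine (hF'.filSum_eq fun N => ?_).symm
  rw [← map_sum, ← map_sub]
  exact hT _ _ (hF.sum_range_sub_filSum_mem hu N)

theorem filSum_mul_filSum {u v : ℕ → B} (hu : ∀ n, u n ∈ F n) (hv : ∀ n, v n ∈ F n) :
    filSum F u * filSum F v
      = filSum F fun n => ∑ ij ∈ Finset.HasAntidiagonal.antidiagonal n, u ij.1 * v ij.2 := by
  refine (hF.filSum_eq fun N => ?_).symm
  have hcauchy : (∑ i ∈ Finset.range N, u i) * (∑ j ∈ Finset.range N, v j)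
      - ∑ n ∈ Finset.range N, ∑ ij ∈ Finset.HasAntidiagonal.antidiagonal n, u ij.1 * v ij.2
        ∈ F N := by
    simp only [Finset.Nat.sum_antidiagonal_eq_sum_range_succ fun i j => u i * v j,
      Finset.sum_range_diag_flip N fun i j => u i * v j, Finset.sum_mul_sum,
      ← Finset.sum_sub_distrib]
    refine (F N).sum_mem fun i _ => ?_
    rw [← Finset.sum_Ico_eq_sub _ (Nat.sub_le N i)]
    refine (F N).sum_mem fun j hj => hF.le_of_le ?_ (hF.mul_mem i j _ _ (hu i) (hv j))
    have := (Finset.mem_Ico.1 hj).1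
    lia
  have hprod : (∑ i ∈ Finset.range N, u i) * (∑ j ∈ Finset.range N, v j)
      - filSum F u * filSum F v ∈ F N := by
    rw [show ∀ a b c d : B, a * b - c * d = (a - c) * b + c * (b - d) by intros; noncomm_ring]
    exact (F N).add_mem (hF.mul_mem_right _ (hF.sum_range_sub_filSum_mem hu N))
      (hF.mul_mem_left _ (hF.sum_range_sub_filSum_mem hv N))
  simpa using (F N).sub_mem hprod hcauchy

end IsCompleteFiltered

namespace IsFilContraction

variable (hF : IsCompleteFiltered F) {m : ℕ} {T : B → B} (hT : IsFilContraction F m T)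
include hF hT

theorem iterate_sub_iterate_mem {x y : B} (hx : x ∈ F m) (hy : y ∈ F m) (n : ℕ) :
    T^[n] x - T^[n] y ∈ F n := by
  induction n with
  | zero => exact hF.mem_zero _
  | succ n ih =>
    rw [Function.iterate_succ_apply', Function.iterate_succ_apply']
    exact hT.sub_mem (hT.mapsTo.iterate n hx) (hT.mapsTo.iterate n hy) ih

theorem iterate_sub_mem_of_isFixedPt {x y : B} (hx : x ∈ F m) (hy : y ∈ F m)
    (hfix : Function.IsFixedPt T y) (n : ℕ) : T^[n] x - y ∈ F n := by
  simpa only [Function.iterate_fixed hfix n] using hT.iterate_sub_iterate_mem hF hx hy n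

theorem eq_of_isFixedPt {x y : B} (hx : x ∈ F m) (hy : y ∈ F m) (hfx : Function.IsFixedPt T x)
    (hfy : Function.IsFixedPt T y) : x = y :=
  hF.eq_of_sub_mem fun n => by
    simpa only [Function.iterate_fixed hfx n] using hT.iterate_sub_mem_of_isFixedPt hF hx hy hfy n

theorem iterate_sub_filLim_mem {x : B} (hx : x ∈ F m) (n : ℕ) :
    T^[n] x - filLim F (fun n => T^[n] x) ∈ F n :=
  hF.sub_filLim_mem (u := fun n => T^[n] x)
    (fun n => by
      simpa only [Function.iterate_succ_apply] using
        hT.iterate_sub_iterate_mem hF (hT.mapsTo hx) hx n) n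

theorem filLim_iterate_mem {x : B} (hx : x ∈ F m) : filLim F (fun n => T^[n] x) ∈ F m := by
  simpa using (F m).sub_mem (hT.mapsTo.iterate m hx) (hT.iterate_sub_filLim_mem hF hx m)

theorem isFixedPt_filLim_iterate {x : B} (hx : x ∈ F m) :
    Function.IsFixedPt T (filLim F fun n => T^[n] x) := by
  refine hF.eq_of_sub_mem fun n => hF.antitone n ?_
  have h := hT.sub_mem (hT.mapsTo.iterate n hx) (hT.filLim_iterate_mem hF hx)
    (hT.iterate_sub_filLim_mem hF hx n)
  rw [← Function.iterate_succ_apply' T] at h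
  simpa using (F (n + 1)).sub_mem (hT.iterate_sub_filLim_mem hF hx (n + 1)) h

end IsFilContraction

end Filtration

/-! ### Power series, exponential, logarithm and the BCH-recursion -/

section PowerSeries

variable {K B B' : Type*} [Field K] [Ring B] [Algebra K B] [Ring B'] [Algebra K B']
  {F : ℕ → Submodule K B} {F' : ℕ → Submodule K B'}

/-- The value `∑ pₙ xⁿ` of a power series `p` at an element `x` of a filtered algebra. -/
def filEval (F : ℕ → Submodule K B) (p : PowerSeries K) (x : B) : B :=
  filSum F fun n => PowerSeries.coeff n p • x ^ n

namespace IsCompleteFiltered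

variable (hF : IsCompleteFiltered F)
include hF

theorem smul_pow_mem (c : K) {x : B} (hx : x ∈ F 1) (n : ℕ) : c • x ^ n ∈ F n :=
  (F n).smul_mem c (hF.pow_mem hx n)

theorem sum_sub_filEval_mem (p : PowerSeries K) {x : B} (hx : x ∈ F 1) (N : ℕ) :
    ∑ n ∈ Finset.range N, PowerSeries.coeff n p • x ^ n - filEval F p x ∈ F N :=
  hF.sum_range_sub_filSum_mem (fun n => hF.smul_pow_mem _ hx n) N

theorem aeval_trunc_sub_filEval_mem (p : PowerSeries K) {x : B} (hx : x ∈ F 1) (N : ℕ) :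
    Polynomial.aeval x (PowerSeries.trunc N p) - filEval F p x ∈ F N := by
  rw [Polynomial.aeval_def, PowerSeries.eval₂_trunc_eq_sum_range]
  simpa only [Algebra.smul_def] using hF.sum_sub_filEval_mem p hx N

theorem filEval_mem_of_constantCoeff {p : PowerSeries K} (hp : PowerSeries.constantCoeff p = 0)
    {x : B} (hx : x ∈ F 1) : filEval F p x ∈ F 1 := by
  simpa [hp] using hF.sum_sub_filEval_mem p hx 1

/-- Evaluation of power series at an element of positive filtration degree, as an algebra
morphism. -/
def filEvalHom {x : B} (hx : x ∈ F 1) : PowerSeries K →ₐ[K] B :=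
  AlgHom.ofLinearMap
    { toFun := fun p => filEval F p x
      map_add' := fun p q => by
        simp only [filEval, map_add, add_smul]
        exact hF.filSum_add (fun n => hF.smul_pow_mem _ hx n) fun n => hF.smul_pow_mem _ hx n
      map_smul' := fun c p => by
        simp only [filEval, PowerSeries.coeff_smul, smul_eq_mul, mul_smul]
        exact (hF.map_filSum hF (T := c • LinearMap.id) (fun n y hy => (F n).smul_mem c hy)
          fun n => hF.smul_pow_mem _ hx n).symm }
    (by
      refine (hF.filSum_eq_single (fun n => hF.smul_pow_mem _ hx n) 0 fun n hn => ?_).trans ?_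
      · rw [PowerSeries.coeff_one, if_neg hn, zero_smul]
      · simp)
    (fun p q => by
      refine Eq.trans ?_ (hF.filSum_mul_filSum (fun n => hF.smul_pow_mem _ hx n)
        fun n => hF.smul_pow_mem _ hx n).symm
      refine congrArg (filSum F) (funext fun n => ?_)
      rw [PowerSeries.coeff_mul, Finset.sum_smul]
      refine Finset.sum_congr rfl fun ij hij => ?_
      rw [smul_mul_smul_comm, ← pow_add, Finset.HasAntidiagonal.mem_antidiagonal.1 hij])

theorem filEvalHom_apply {x : B} (hx : x ∈ F 1) (p : PowerSeries K) :
    hF.filEvalHom hx p = filEval F p x := rfl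

theorem filEvalHom_X {x : B} (hx : x ∈ F 1) : hF.filEvalHom hx PowerSeries.X = x := by
  refine (hF.filSum_eq_single (fun n => hF.smul_pow_mem _ hx n) 1 fun n hn => ?_).trans ?_
  · rw [PowerSeries.coeff_X, if_neg hn, zero_smul]
  · simp

theorem filEval_subst (p : PowerSeries K) {q : PowerSeries K}
    (hq : PowerSeries.constantCoeff q = 0) {x : B} (hx : x ∈ F 1) :
    filEval F (p.subst q) x = filEval F p (filEval F q x) := by
  have hy := hF.filEval_mem_of_constantCoeff hq hx
  have hs : PowerSeries.HasSubst q := PowerSeries.HasSubst.of_constantCoeff_zero' hq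
  refine hF.eq_of_sub_mem fun N => ?_
  have hsplit : p.subst q = q ^ N * (PowerSeries.mk fun i => PowerSeries.coeff (i + N) p).subst q
      + Polynomial.aeval q (PowerSeries.trunc N p) := by
    conv_lhs => rw [PowerSeries.eq_X_pow_mul_shift_add_trunc N p]
    rw [PowerSeries.subst_add hs, PowerSeries.subst_mul hs, PowerSeries.subst_pow hs,
      PowerSeries.subst_X hs, PowerSeries.subst_coe hs]
  rw [hsplit, ← hF.filEvalHom_apply hx, map_add, map_mul, map_pow, ← Polynomial.aeval_algHom_apply,
    add_sub_assoc]
  exact (F N).add_mem (hF.mul_mem_right _ (hF.pow_mem hy N)) (hF.aeval_trunc_sub_filEval_mem p hy N)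

theorem filEval_sub_filEval_mem {p : PowerSeries K} (hp : PowerSeries.coeff 1 p = 0) {x y : B}
    (hx : x ∈ F 1) (hy : y ∈ F 1) {n : ℕ} (h : x - y ∈ F n) :
    filEval F p x - filEval F p y ∈ F (n + 1) := by
  have hsum : ∑ i ∈ Finset.range (n + 1), PowerSeries.coeff i p • x ^ i
      - ∑ i ∈ Finset.range (n + 1), PowerSeries.coeff i p • y ^ i ∈ F (n + 1) := by
    rw [← Finset.sum_sub_distrib]
    refine (F _).sum_mem fun i _ => ?_
    rw [← smul_sub]
    match i with
    | 0 => simp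
    | 1 => simp [hp]
    | i + 2 => exact (F _).smul_mem _ (hF.le_of_le (by lia) (hF.pow_sub_pow_mem hx hy h (i + 1)))
  have hrest := (F (n + 1)).sub_mem (hF.sum_sub_filEval_mem p hx (n + 1))
    (hF.sum_sub_filEval_mem p hy (n + 1))
  rw [sub_sub_sub_comm] at hrest
  simpa using (F (n + 1)).sub_mem hsum hrest

theorem map_filExp (hF' : IsCompleteFiltered F') {T : B →ₐ[K] B'}
    (hT : ∀ n x, x ∈ F n → T x ∈ F' n) {x : B} (hx : x ∈ F 1) :
    T (filExp F x) = filExp F' (T x) := by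
  refine (hF.map_filSum hF' (T := T.toLinearMap) hT fun n => hF.smul_pow_mem _ hx n).trans ?_
  simp only [AlgHom.toLinearMap_apply, map_smul, map_pow, filExp, filSum]

theorem filExp_zero : filExp F (0 : B) = 1 := by
  refine (hF.filSum_eq_single (fun n => hF.smul_pow_mem _ (F 1).zero_mem n) 0
    fun n hn => ?_).trans ?_
  · rw [zero_pow hn, smul_zero]
  · simp

end IsCompleteFiltered

/-- One step `x ↦ b - BCH(P(x), (id - P)(x))` of the BCH-recursion. -/
def chiStep (F : ℕ → Submodule K B) (P : B →ₗ[K] B) (b x : B) : B :=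
  b - filBCH F (P x) (x - P x)

theorem chiApprox_eq_iterate (P : B →ₗ[K] B) (b : B) :
    chiApprox F P b = fun n => (chiStep F P b)^[n] b := by
  funext n
  induction n with
  | zero => rfl
  | succ n ih => rw [Function.iterate_succ_apply', ← ih, chiApprox, chiStep]

end PowerSeries

section ExpLog

variable {K B : Type*} [Field K] [CharZero K] [Ring B] [Algebra K B] {F : ℕ → Submodule K B}

theorem filExp_eq_filEval (x : B) : filExp F x = filEval F (PowerSeries.exp K) x := by
  simp [filExp, filEval, filSum, PowerSeries.coeff_exp]

namespace IsCompleteFiltered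

variable (hF : IsCompleteFiltered F)
include hF

theorem filExp_sub_one_mem {x : B} (hx : x ∈ F 1) : filExp F x - 1 ∈ F 1 := by
  rw [filExp_eq_filEval, ← neg_sub, Submodule.neg_mem_iff]
  simpa using hF.sum_sub_filEval_mem (PowerSeries.exp K) hx 1

theorem filExp_add_of_commute {x y : B} (hx : x ∈ F 1) (hy : y ∈ F 1) (h : Commute x y) :
    filExp F (x + y) = filExp F x * filExp F y := by
  refine Eq.trans ?_ (hF.filSum_mul_filSum (fun n => hF.smul_pow_mem _ hx n)
    fun n => hF.smul_pow_mem _ hy n).symm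
  refine congrArg (filSum F) (funext fun n => ?_)
  rw [h.add_pow', Finset.smul_sum]
  refine Finset.sum_congr rfl fun ij hij => ?_
  rw [← Finset.HasAntidiagonal.mem_antidiagonal.1 hij, smul_mul_smul_comm,
    ← Nat.cast_smul_eq_nsmul K, smul_smul, Nat.cast_add_choose]
  have := Nat.cast_ne_zero (R := K).2 (ij.1 + ij.2).factorial_ne_zero
  congr 1
  field_simp

theorem filExp_mul_filExp_neg {x : B} (hx : x ∈ F 1) : filExp F x * filExp F (-x) = 1 := by
  rw [← hF.filExp_add_of_commute hx ((F 1).neg_mem hx) (Commute.refl x).neg_right, add_neg_cancel,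
    hF.filExp_zero]

theorem filExp_neg_mul_filExp {x : B} (hx : x ∈ F 1) : filExp F (-x) * filExp F x = 1 := by
  simpa using hF.filExp_mul_filExp_neg ((F 1).neg_mem hx)

theorem isUnit_filExp {x : B} (hx : x ∈ F 1) : IsUnit (filExp F x) :=
  ⟨⟨_, _, hF.filExp_mul_filExp_neg hx, hF.filExp_neg_mul_filExp hx⟩, rfl⟩

theorem inverse_filExp {x : B} (hx : x ∈ F 1) : Ring.inverse (filExp F x) = filExp F (-x) :=
  Ring.inverse_unit ⟨_, _, hF.filExp_mul_filExp_neg hx, hF.filExp_neg_mul_filExp hx⟩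

theorem filExp_sub_self_sub_mem {x y : B} (hx : x ∈ F 1) (hy : y ∈ F 1) {n : ℕ}
    (h : x - y ∈ F n) : (filExp F x - x) - (filExp F y - y) ∈ F (n + 1) := by
  have hhigher : ∀ z ∈ F 1, filExp F z - z = filEval F (PowerSeries.exp K - PowerSeries.X) z := by
    intro z hz
    rw [filExp_eq_filEval, ← hF.filEvalHom_apply hz, ← hF.filEvalHom_apply hz, map_sub,
      hF.filEvalHom_X]
  rw [hhigher x hx, hhigher y hy]
  exact hF.filEval_sub_filEval_mem (by simp [PowerSeries.coeff_exp]) hx hy h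

theorem filExp_sub_filExp_mem {x y : B} (hx : x ∈ F 1) (hy : y ∈ F 1) {n : ℕ} (h : x - y ∈ F n) :
    filExp F x - filExp F y ∈ F n := by
  have hhigher := hF.filExp_sub_self_sub_mem hx hy h
  rw [sub_sub_sub_comm] at hhigher
  simpa using (F n).add_mem (hF.antitone n hhigher) h

theorem filExp_injOn : Set.InjOn (filExp F) (F 1) := by
  intro x hx y hy hxy
  have hT : IsFilContraction F 1 fun z => z + (filExp F y - filExp F z) :=
    { mapsTo := fun z hz =>
        (F 1).add_mem hz (hF.filExp_sub_filExp_mem hy hz ((F 1).sub_mem hy hz))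
      sub_mem := fun n z w hz hw h => by
        convert (F _).neg_mem (hF.filExp_sub_self_sub_mem hz hw h) using 1
        abel }
  exact hT.eq_of_isFixedPt hF hx hy (by simp [Function.IsFixedPt, hxy])
    (by simp [Function.IsFixedPt])

theorem filLog_eq_filEval {y : B} (hy : y - 1 ∈ F 1) :
    filLog F y = filEval F (PowerSeries.log K) (y - 1) := by
  have hterm : ∀ n, -((((n + 1 : ℕ) : K)⁻¹) • (-(y - 1)) ^ (n + 1))
      = PowerSeries.coeff (n + 1) (PowerSeries.log K) • (y - 1) ^ (n + 1) := by
    intro n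
    rw [PowerSeries.coeff_log, if_neg n.succ_ne_zero, ← neg_one_smul K (y - 1), smul_pow, smul_smul,
      ← neg_smul]
    congr 1
    simp [pow_succ, div_eq_inv_mul]
  rw [filEval, hF.filSum_eq_zero_add fun n => hF.smul_pow_mem _ hy n,
    PowerSeries.coeff_log, if_pos rfl, zero_smul, zero_add]
  simp only [filLog, filSum, ← hterm, Finset.sum_neg_distrib]

theorem filLog_mem {y : B} (hy : y - 1 ∈ F 1) : filLog F y ∈ F 1 := by
  rw [hF.filLog_eq_filEval hy]
  exact hF.filEval_mem_of_constantCoeff PowerSeries.constantCoeff_log hy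

theorem filExp_filLog {y : B} (hy : y - 1 ∈ F 1) : filExp F (filLog F y) = y := by
  rw [filExp_eq_filEval, hF.filLog_eq_filEval hy,
    ← hF.filEval_subst _ PowerSeries.constantCoeff_log hy, exp_subst_log,
    ← hF.filEvalHom_apply hy, map_add, map_one, hF.filEvalHom_X, add_sub_cancel]

theorem eq_filLog {x y : B} (hx : x ∈ F 1) (hy : y - 1 ∈ F 1) (h : filExp F x = y) :
    x = filLog F y :=
  hF.filExp_injOn hx (hF.filLog_mem hy) (h.trans (hF.filExp_filLog hy).symm)

theorem filLog_sub_self_sub_mem {x y : B} (hx : x - 1 ∈ F 1) (hy : y - 1 ∈ F 1) {n : ℕ}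
    (h : x - y ∈ F n) : (filLog F x - x) - (filLog F y - y) ∈ F (n + 1) := by
  have hhigher : ∀ z, z - 1 ∈ F 1 →
      filLog F z - z = filEval F (PowerSeries.log K - PowerSeries.X) (z - 1) - 1 := by
    intro z hz
    rw [hF.filLog_eq_filEval hz, ← hF.filEvalHom_apply hz, ← hF.filEvalHom_apply hz, map_sub,
      hF.filEvalHom_X]
    abel
  rw [hhigher x hx, hhigher y hy, sub_sub_sub_cancel_right]
  exact hF.filEval_sub_filEval_mem (by simp) hx hy (by simpa using h)

theorem isUnit_of_sub_one_mem {y : B} (hy : y - 1 ∈ F 1) : IsUnit y := by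
  rw [← hF.filExp_filLog hy]
  exact hF.isUnit_filExp (hF.filLog_mem hy)

theorem filExp_mul_filExp_sub_one_mem {x y : B} (hx : x ∈ F 1) (hy : y ∈ F 1) :
    filExp F x * filExp F y - 1 ∈ F 1 :=
  hF.mul_sub_one_mem (hF.filExp_sub_one_mem hx) (hF.filExp_sub_one_mem hy)

theorem filBCH_mem {x y : B} (hx : x ∈ F 1) (hy : y ∈ F 1) : filBCH F x y ∈ F 1 :=
  (F 1).sub_mem ((F 1).sub_mem (hF.filLog_mem (hF.filExp_mul_filExp_sub_one_mem hx hy)) hx) hy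

theorem filExp_add_filBCH {x y : B} (hx : x ∈ F 1) (hy : y ∈ F 1) :
    filExp F (x + y + filBCH F x y) = filExp F x * filExp F y := by
  rw [filBCH, sub_sub, add_sub_cancel]
  exact hF.filExp_filLog (hF.filExp_mul_filExp_sub_one_mem hx hy)

theorem filExp_mul_filExp_sub_mem {x x' y y' : B} (hx : x ∈ F 1) (hx' : x' ∈ F 1) (hy : y ∈ F 1)
    (hy' : y' ∈ F 1) {n : ℕ} (h : x - x' ∈ F n) (h' : y - y' ∈ F n) :
    (filExp F x * filExp F y - x - y) - (filExp F x' * filExp F y' - x' - y') ∈ F (n + 1) := by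
  have hmul := hF.mul_mem n 1 _ _ (hF.filExp_sub_filExp_mem hx hx' h) (hF.filExp_sub_one_mem hy)
  have hmul' := hF.mul_mem 1 n _ _ (hF.filExp_sub_one_mem hx') (hF.filExp_sub_filExp_mem hy hy' h')
  rw [add_comm] at hmul'
  have hexp := (F _).add_mem (hF.filExp_sub_self_sub_mem hx hx' h)
    (hF.filExp_sub_self_sub_mem hy hy' h')
  convert (F _).add_mem hexp ((F _).add_mem hmul hmul') using 1
  noncomm_ring

theorem filBCH_sub_filBCH_mem {x x' y y' : B} (hx : x ∈ F 1) (hx' : x' ∈ F 1) (hy : y ∈ F 1)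
    (hy' : y' ∈ F 1) {n : ℕ} (h : x - x' ∈ F n) (h' : y - y' ∈ F n) :
    filBCH F x y - filBCH F x' y' ∈ F (n + 1) := by
  have hmul := hF.filExp_mul_filExp_sub_mem hx hx' hy hy' h h'
  have hmul_mem : filExp F x * filExp F y - filExp F x' * filExp F y' ∈ F n := by
    convert (F n).add_mem (hF.antitone n hmul) ((F n).add_mem h h') using 1
    abel
  have hlog := hF.filLog_sub_self_sub_mem (hF.filExp_mul_filExp_sub_one_mem hx hy)
    (hF.filExp_mul_filExp_sub_one_mem hx' hy') hmul_mem
  convert (F _).add_mem hlog hmul using 1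
  unfold filBCH
  abel

variable {P : B →ₗ[K] B} (hP : ∀ n x, x ∈ F n → P x ∈ F n)
include hP

theorem isFilContraction_chiStep {b : B} (hb : b ∈ F 1) : IsFilContraction F 1 (chiStep F P b) where
  mapsTo x hx := (F 1).sub_mem hb (hF.filBCH_mem (hP 1 _ hx) ((F 1).sub_mem hx (hP 1 _ hx)))
  sub_mem n x y hx hy h := by
    have hPxy : P x - P y ∈ F n := by simpa using hP n _ h
    rw [chiStep, chiStep, sub_sub_sub_cancel_left]
    refine hF.filBCH_sub_filBCH_mem (hP 1 _ hy) (hP 1 _ hx) ((F 1).sub_mem hy (hP 1 _ hy))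
      ((F 1).sub_mem hx (hP 1 _ hx)) (sub_mem_comm_iff.1 hPxy) ?_
    rw [sub_sub_sub_comm]
    exact (F n).sub_mem (sub_mem_comm_iff.1 h) (sub_mem_comm_iff.1 hPxy)

theorem isFilLimit_chi {b : B} (hb : b ∈ F 1) : IsFilLimit F (chiApprox F P b) (chi F P b) := by
  rw [chi, chiApprox_eq_iterate]
  exact hF.isFilLimit_of_sub_mem ((hF.isFilContraction_chiStep hP hb).iterate_sub_filLim_mem hF hb)

theorem chi_mem {b : B} (hb : b ∈ F 1) : chi F P b ∈ F 1 := by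
  rw [chi, chiApprox_eq_iterate]
  exact (hF.isFilContraction_chiStep hP hb).filLim_iterate_mem hF hb

theorem chi_eq {b : B} (hb : b ∈ F 1) :
    chi F P b = b - filBCH F (P (chi F P b)) (chi F P b - P (chi F P b)) := by
  have h := (hF.isFilContraction_chiStep hP hb).isFixedPt_filLim_iterate hF hb
  rw [← chiApprox_eq_iterate] at h
  exact h.symm

theorem filExp_eq_mul_filExp_chi {b : B} (hb : b ∈ F 1) :
    filExp F b = filExp F (P (chi F P b)) * filExp F (chi F P b - P (chi F P b)) := by
  have hc := hF.chi_mem hP hb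
  rw [← hF.filExp_add_filBCH (hP 1 _ hc) ((F 1).sub_mem hc (hP 1 _ hc)), add_sub_cancel,
    eq_sub_iff_add_eq.1 (hF.chi_eq hP hb)]

end IsCompleteFiltered

end ExpLog

/-! ### Atkinson's recursions and Spitzer's identity -/

section RotaBaxter

variable {K B : Type*} [Field K] [Ring B] [Algebra K B] {F : ℕ → Submodule K B} {R : B →ₗ[K] B}

theorem leftIter_eq_iterate (a : B) (n : ℕ) :
    leftIter R a n = (R ∘ₗ LinearMap.mulRight K a)^[n] 1 := by
  induction n with
  | zero => rfl
  | succ n ih => rw [Function.iterate_succ_apply', ← ih]; rfl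

theorem rightIter_eq_iterate (a : B) (n : ℕ) :
    rightIter R a n = (R ∘ₗ LinearMap.mulLeft K a)^[n] 1 := by
  induction n with
  | zero => rfl
  | succ n ih => rw [Function.iterate_succ_apply', ← ih]; rfl

theorem iterate_one_sub_eq_sum (L : B →ₗ[K] B) (N : ℕ) :
    (fun X => 1 - L X)^[N] 0 = ∑ n ∈ Finset.range N, (-1) ^ n * L^[n] 1 := by
  have hterm : ∀ n, (-1) ^ (n + 1) * L^[n + 1] 1 = -L ((-1) ^ n * L^[n] 1) := fun n => by
    rw [Function.iterate_succ_apply', pow_succ, mul_neg_one, neg_mul]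
    rcases neg_one_pow_eq_or B n with h | h <;> simp [h]
  induction N with
  | zero => rfl
  | succ N ih =>
    rw [Function.iterate_succ_apply', ih, Finset.sum_range_succ', map_sum]
    simp only [hterm, Finset.sum_neg_distrib]
    rw [sub_eq_neg_add, pow_zero, Function.iterate_zero_apply, one_mul]

namespace IsCompleteFiltered

variable (hF : IsCompleteFiltered F)
include hF

theorem isFilContraction_one_sub {L : B →ₗ[K] B} (hL : ∀ n x, x ∈ F n → L x ∈ F (n + 1)) :
    IsFilContraction F 0 fun X => 1 - L X where
  mapsTo _ _ := hF.mem_zero _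
  sub_mem n x y _ _ h := by
    rw [sub_sub_sub_cancel_left, ← map_sub]
    exact hL n _ (sub_mem_comm_iff.1 h)

theorem isFilLimit_sum_iterate {L : B →ₗ[K] B} (hL : ∀ n x, x ∈ F n → L x ∈ F (n + 1)) {X : B}
    (hX : X = 1 - L X) : IsFilLimit F (fun N => ∑ n ∈ Finset.range N, (-1) ^ n * L^[n] 1) X := by
  simp only [← iterate_one_sub_eq_sum]
  exact hF.isFilLimit_of_sub_mem ((hF.isFilContraction_one_sub hL).iterate_sub_mem_of_isFixedPt hF
    (hF.mem_zero 0) (hF.mem_zero X) hX.symm)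

variable (hR : ∀ n x, x ∈ F n → R x ∈ F n) {a : B} (ha : a ∈ F 1)
include hR ha

theorem map_mulRight_mem (n : ℕ) (x : B) (hx : x ∈ F n) :
    (R ∘ₗ LinearMap.mulRight K a) x ∈ F (n + 1) :=
  hR _ _ (hF.mul_mem n 1 x a hx ha)

theorem map_mulLeft_mem (n : ℕ) (x : B) (hx : x ∈ F n) :
    (R ∘ₗ LinearMap.mulLeft K a) x ∈ F (n + 1) :=
  hR _ _ (add_comm 1 n ▸ hF.mul_mem 1 n a x ha hx)

theorem eq_of_eq_one_sub_map_mul_right {X Y : B} (hX : X = 1 - R (X * a))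
    (hY : Y = 1 - R (Y * a)) : X = Y :=
  (hF.isFilContraction_one_sub (hF.map_mulRight_mem hR ha)).eq_of_isFixedPt hF (hF.mem_zero X)
    (hF.mem_zero Y) hX.symm hY.symm

theorem eq_of_eq_one_sub_map_mul_left {X Y : B} (hX : X = 1 - R (a * X))
    (hY : Y = 1 - R (a * Y)) : X = Y :=
  (hF.isFilContraction_one_sub (hF.map_mulLeft_mem hR ha)).eq_of_isFixedPt hF (hF.mem_zero X)
    (hF.mem_zero Y) hX.symm hY.symm

theorem isFilLimit_leftIter {X : B} (hX : X = 1 - R (X * a)) :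
    IsFilLimit F (fun N => ∑ n ∈ Finset.range N, (-1) ^ n * leftIter R a n) X := by
  simp only [leftIter_eq_iterate]
  exact hF.isFilLimit_sum_iterate (hF.map_mulRight_mem hR ha) hX

theorem isFilLimit_rightIter {X : B} (hX : X = 1 - R (a * X)) :
    IsFilLimit F (fun N => ∑ n ∈ Finset.range N, (-1) ^ n * rightIter R a n) X := by
  simp only [rightIter_eq_iterate]
  exact hF.isFilLimit_sum_iterate (hF.map_mulLeft_mem hR ha) hX

end IsCompleteFiltered

theorem IsRotaBaxter.map_doubleMul (hR : IsRotaBaxter (1 : K) R) (x y : B) :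
    R (doubleMul R x y) = R x * R y := by
  rw [hR x y, one_smul, doubleMul]

theorem IsRotaBaxter.map_sub_doubleMul (hR : IsRotaBaxter (1 : K) R) (x y : B) :
    R (doubleMul R x y) - doubleMul R x y = (R x - x) * (R y - y) := by
  rw [hR.map_doubleMul]
  unfold doubleMul
  noncomm_ring

theorem map_doublePow {T : B →ₗ[K] B} (hT : ∀ x y, T (doubleMul R x y) = T x * T y) (x : B)
    (n : ℕ) : T (doublePow R x n) = T x ^ (n + 1) := by
  induction n with
  | zero => simp [doublePow]
  | succ n ih => rw [doublePow, hT, ih, ← pow_succ]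

namespace IsCompleteFiltered

variable (hF : IsCompleteFiltered F) (hR : ∀ n x, x ∈ F n → R x ∈ F n)
include hF hR

theorem doublePow_mem {x : B} (hx : x ∈ F 1) (n : ℕ) : doublePow R x n ∈ F (n + 1) := by
  induction n with
  | zero => exact hx
  | succ n ih =>
    have hmul : ∀ {y z}, y ∈ F (n + 1) → z ∈ F 1 → y * z ∈ F (n + 1 + 1) := hF.mul_mem _ _ _ _
    exact (F _).sub_mem ((F _).add_mem (hmul (hR _ _ ih) hx) (hmul ih (hR _ _ hx))) (hmul ih hx)

/-- Spitzer's identity, for `T = R` and for `T = R - id`. -/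
theorem map_doubleExp_sub_one {T : B →ₗ[K] B} (hTF : ∀ n x, x ∈ F n → T x ∈ F n)
    (hT : ∀ x y, T (doubleMul R x y) = T x * T y) {x : B} (hx : x ∈ F 1) :
    T (doubleExp F R x - 1) = filExp F (T x) - 1 := by
  have hterm : ∀ n, ((n + 1).factorial : K)⁻¹ • doublePow R x n ∈ F n := fun n =>
    (F n).smul_mem _ (hF.antitone n (hF.doublePow_mem hR hx n))
  rw [doubleExp, add_sub_cancel_left]
  refine (hF.map_filSum hF hTF hterm).trans (eq_sub_of_add_eq' ?_)
  simp only [map_smul, map_doublePow hT]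
  refine Eq.trans ?_ (hF.filSum_eq_zero_add fun n => hF.smul_pow_mem _ (hTF 1 x hx) n).symm
  simp

end IsCompleteFiltered

end RotaBaxter

/-! ### The Birkhoff decomposition -/

section Birkhoff

variable {K B : Type*} [Field K] [Ring B] [Algebra K B]
  {F : ℕ → Submodule K B} {R : B →ₗ[K] B}

/-- The counterterm `φ₋ = exp (-R(χ(log φ)))` of the Birkhoff decomposition `φ = φ₋⁻¹ * φ₊`. -/
def birkhoffMinus (F : ℕ → Submodule K B) (R : B →ₗ[K] B) (φ : B) : B :=
  filExp F (-R (chi F R (filLog F φ)))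

/-- The renormalised part `φ₊ = exp (χ(log φ) - R(χ(log φ)))` of the Birkhoff decomposition
`φ = φ₋⁻¹ * φ₊`. -/
def birkhoffPlus (F : ℕ → Submodule K B) (R : B →ₗ[K] B) (φ : B) : B :=
  filExp F (chi F R (filLog F φ) - R (chi F R (filLog F φ)))

namespace IsCompleteFilteredRotaBaxter

variable (h : IsCompleteFilteredRotaBaxter (1 : K) F R)
include h

theorem sub_map_mem {n : ℕ} {x : B} (hx : x ∈ F n) : x - R x ∈ F n :=
  (F n).sub_mem hx (h.map_mem n x hx)

theorem map_doubleExp_sub_one {x : B} (hx : x ∈ F 1) :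
    R (doubleExp F R x - 1) = filExp F (R x) - 1 :=
  h.completeFiltered.map_doubleExp_sub_one h.map_mem h.map_mem h.rotaBaxter.map_doubleMul hx

theorem doubleExp_sub_one_eq {x : B} (hx : x ∈ F 1) :
    doubleExp F R x - 1 = filExp F (R x) - filExp F (R x - x) := by
  have hsub := h.completeFiltered.map_doubleExp_sub_one (T := R - LinearMap.id) h.map_mem
    (fun n y hy => (F n).sub_mem (h.map_mem n y hy) hy) h.rotaBaxter.map_sub_doubleMul hx
  simp only [LinearMap.sub_apply, LinearMap.id_apply, h.map_doubleExp_sub_one hx] at hsub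
  rw [← sub_sub_cancel (filExp F (R x) - 1) (doubleExp F R x - 1), hsub, sub_sub_sub_cancel_right]

variable [CharZero K] {φ : B} (hφ : φ - 1 ∈ F 1)
include hφ

theorem chi_filLog_mem : chi F R (filLog F φ) ∈ F 1 :=
  h.completeFiltered.chi_mem h.map_mem (h.completeFiltered.filLog_mem hφ)

theorem eq_filExp_mul_filExp_chi :
    φ = filExp F (R (chi F R (filLog F φ)))
      * filExp F (chi F R (filLog F φ) - R (chi F R (filLog F φ))) := by
  have hF := h.completeFiltered
  rw [← hF.filExp_eq_mul_filExp_chi h.map_mem (hF.filLog_mem hφ), hF.filExp_filLog hφ]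

theorem isUnit_birkhoffMinus : IsUnit (birkhoffMinus F R φ) :=
  h.completeFiltered.isUnit_filExp ((F 1).neg_mem (h.map_mem 1 _ (h.chi_filLog_mem hφ)))

theorem inverse_birkhoffMinus :
    Ring.inverse (birkhoffMinus F R φ) = filExp F (R (chi F R (filLog F φ))) := by
  rw [birkhoffMinus, h.completeFiltered.inverse_filExp
    ((F 1).neg_mem (h.map_mem 1 _ (h.chi_filLog_mem hφ))), neg_neg]

theorem isUnit_birkhoffPlus : IsUnit (birkhoffPlus F R φ) :=
  h.completeFiltered.isUnit_filExp (h.sub_map_mem (h.chi_filLog_mem hφ))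

theorem inverse_birkhoffPlus :
    Ring.inverse (birkhoffPlus F R φ)
      = filExp F (-(chi F R (filLog F φ) - R (chi F R (filLog F φ)))) :=
  h.completeFiltered.inverse_filExp (h.sub_map_mem (h.chi_filLog_mem hφ))

theorem inverse_birkhoffMinus_mul :
    Ring.inverse (birkhoffMinus F R φ) * birkhoffPlus F R φ = φ := by
  rw [h.inverse_birkhoffMinus hφ, birkhoffPlus, ← h.eq_filExp_mul_filExp_chi hφ]

theorem birkhoffMinus_mul : birkhoffMinus F R φ * φ = birkhoffPlus F R φ := by
  conv_lhs => enter [2]; rw [← h.inverse_birkhoffMinus_mul hφ]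
  rw [Ring.mul_inverse_cancel_left _ _ (h.isUnit_birkhoffMinus hφ)]

theorem birkhoffMinus_mul_sub_one :
    birkhoffMinus F R φ * (φ - 1) = 1 - doubleExp F R (-chi F R (filLog F φ)) := by
  rw [← neg_sub (doubleExp F R _), h.doubleExp_sub_one_eq ((F 1).neg_mem (h.chi_filLog_mem hφ)),
    mul_sub, h.birkhoffMinus_mul hφ, mul_one, map_neg, neg_sub, sub_neg_eq_add, neg_add_eq_sub]
  rfl

theorem map_birkhoffMinus_mul_sub_one :
    R (birkhoffMinus F R φ * (φ - 1)) = 1 - birkhoffMinus F R φ := by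
  rw [h.birkhoffMinus_mul_sub_one hφ, ← neg_sub, map_neg,
    h.map_doubleExp_sub_one ((F 1).neg_mem (h.chi_filLog_mem hφ)), map_neg, neg_sub, birkhoffMinus]

theorem id_sub_map_birkhoffMinus_mul_sub_one :
    (LinearMap.id - R : B →ₗ[K] B) (birkhoffMinus F R φ * (φ - 1)) = birkhoffPlus F R φ - 1 := by
  rw [LinearMap.sub_apply, h.map_birkhoffMinus_mul_sub_one hφ, LinearMap.id_apply, mul_sub,
    h.birkhoffMinus_mul hφ, mul_one, sub_sub_sub_cancel_right]

theorem birkhoffMinus_eq_one_sub :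
    birkhoffMinus F R φ = 1 - R (birkhoffMinus F R φ * (φ - 1)) := by
  rw [h.map_birkhoffMinus_mul_sub_one hφ, sub_sub_cancel]

theorem eq_birkhoffMinus {X : B} (hX : X = 1 - R (X * (φ - 1))) : X = birkhoffMinus F R φ :=
  h.completeFiltered.eq_of_eq_one_sub_map_mul_right h.map_mem hφ hX (h.birkhoffMinus_eq_one_sub hφ)

theorem isFilLimit_leftIter_birkhoffMinus :
    IsFilLimit F (fun N => ∑ n ∈ Finset.range N, (-1) ^ n * leftIter R (φ - 1) n)
      (birkhoffMinus F R φ) :=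
  h.completeFiltered.isFilLimit_leftIter h.map_mem hφ (h.birkhoffMinus_eq_one_sub hφ)

theorem sub_one_mul_inverse_birkhoffPlus :
    (φ - 1) * Ring.inverse (birkhoffPlus F R φ)
      = doubleExp F R (chi F R (filLog F φ)) - 1 := by
  have hc := h.chi_filLog_mem hφ
  rw [sub_mul, one_mul, h.doubleExp_sub_one_eq hc]
  conv_lhs => enter [1, 1]; rw [← h.inverse_birkhoffMinus_mul hφ]
  rw [Ring.mul_inverse_cancel_right _ _ (h.isUnit_birkhoffPlus hφ), h.inverse_birkhoffMinus hφ,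
    h.inverse_birkhoffPlus hφ, neg_sub]

theorem inverse_birkhoffPlus_eq_one_sub :
    Ring.inverse (birkhoffPlus F R φ)
      = 1 - (LinearMap.id - R : B →ₗ[K] B) ((φ - 1) * Ring.inverse (birkhoffPlus F R φ)) := by
  have hc := h.chi_filLog_mem hφ
  rw [h.sub_one_mul_inverse_birkhoffPlus hφ, LinearMap.sub_apply, h.map_doubleExp_sub_one hc,
    LinearMap.id_apply, h.doubleExp_sub_one_eq hc, sub_sub_sub_cancel_left, sub_sub_cancel,
    h.inverse_birkhoffPlus hφ, neg_sub]

theorem eq_inverse_birkhoffPlus {Y : B}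
    (hY : Y = 1 - (LinearMap.id - R : B →ₗ[K] B) ((φ - 1) * Y)) :
    Y = Ring.inverse (birkhoffPlus F R φ) :=
  h.completeFiltered.eq_of_eq_one_sub_map_mul_left (fun _ _ => h.sub_map_mem) hφ hY
    (h.inverse_birkhoffPlus_eq_one_sub hφ)

theorem isFilLimit_rightIter_inverse_birkhoffPlus :
    IsFilLimit F
      (fun N => ∑ n ∈ Finset.range N, (-1) ^ n * rightIter (LinearMap.id - R) (φ - 1) n)
      (Ring.inverse (birkhoffPlus F R φ)) :=
  h.completeFiltered.isFilLimit_rightIter (fun _ _ => h.sub_map_mem) hφ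
    (h.inverse_birkhoffPlus_eq_one_sub hφ)

theorem birkhoffPlus_eq_one_sub :
    birkhoffPlus F R φ
      = 1 - (LinearMap.id - R : B →ₗ[K] B) (birkhoffPlus F R φ * (Ring.inverse φ - 1)) := by
  have hmul : birkhoffPlus F R φ * (Ring.inverse φ - 1) = -(birkhoffMinus F R φ * (φ - 1)) := by
    rw [← h.birkhoffMinus_mul hφ, mul_sub, mul_sub, mul_one, mul_one,
      Ring.mul_inverse_cancel_right _ _ (h.completeFiltered.isUnit_of_sub_one_mem hφ), neg_sub]
  rw [hmul, map_neg, h.id_sub_map_birkhoffMinus_mul_sub_one hφ, sub_neg_eq_add, add_sub_cancel]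

theorem birkhoffMinus_mem_oneAddRange : birkhoffMinus F R φ ∈ oneAddRange F R := by
  refine ⟨-(birkhoffMinus F R φ * (φ - 1)),
    (F 1).neg_mem (h.completeFiltered.mul_mem_left _ hφ), ?_⟩
  rw [map_neg, ← sub_eq_add_neg]
  exact h.birkhoffMinus_eq_one_sub hφ

theorem birkhoffPlus_mem_oneAddRange :
    birkhoffPlus F R φ ∈ oneAddRange F (LinearMap.id - R) := by
  refine ⟨birkhoffMinus F R φ * (φ - 1), h.completeFiltered.mul_mem_left _ hφ, ?_⟩
  rw [h.id_sub_map_birkhoffMinus_mul_sub_one hφ, add_sub_cancel]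

theorem eq_birkhoff_of_eq_inverse_mul (hR : ∀ x, R (R x) = R x) {ψm ψp : B}
    (hm : ψm ∈ oneAddRange F R) (hp : ψp ∈ oneAddRange F (LinearMap.id - R))
    (hψ : φ = Ring.inverse ψm * ψp) : ψm = birkhoffMinus F R φ ∧ ψp = birkhoffPlus F R φ := by
  obtain ⟨u, hu, hψm⟩ := hm
  obtain ⟨v, -, hψp⟩ := hp
  have hunit : IsUnit ψm :=
    h.completeFiltered.isUnit_of_sub_one_mem (by simpa [hψm] using h.map_mem 1 u hu)
  have hmul : ψm * φ = ψp := by rw [hψ, Ring.mul_inverse_cancel_left _ _ hunit]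
  have hrec : ψm = 1 - R (ψm * (φ - 1)) := by
    rw [mul_sub, hmul, mul_one, hψp, hψm, add_sub_add_left_eq_sub]
    simp [hR]
  have hminus := h.eq_birkhoffMinus hφ hrec
  exact ⟨hminus, by rw [← hmul, hminus, h.birkhoffMinus_mul hφ]⟩

theorem map_doubleExp_neg_chi :
    R (doubleExp F R (-chi F R (filLog F φ))) = R 1 + (birkhoffMinus F R φ - 1) := by
  rw [← sub_sub_cancel 1 (doubleExp _ _ _), ← h.birkhoffMinus_mul_sub_one hφ, map_sub,
    h.map_birkhoffMinus_mul_sub_one hφ, sub_eq_add_neg, neg_sub]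

theorem id_sub_map_doubleExp_neg_chi :
    (LinearMap.id - R : B →ₗ[K] B) (doubleExp F R (-chi F R (filLog F φ)))
      = 2 - birkhoffPlus F R φ - R 1 := by
  rw [← sub_sub_cancel 1 (doubleExp _ _ _), ← h.birkhoffMinus_mul_sub_one hφ, map_sub,
    h.id_sub_map_birkhoffMinus_mul_sub_one hφ, LinearMap.sub_apply, LinearMap.id_apply,
    ← one_add_one_eq_two]
  abel

end IsCompleteFilteredRotaBaxter

end Birkhoff

/-! ### The filtration of the convolution algebra -/

section TensorFiltration

variable {K M N : Type*} [CommSemiring K] [AddCommMonoid M] [Module K M]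
  [AddCommMonoid N] [Module K N]
  {V : ℕ → Submodule K M} {W : ℕ → Submodule K N}

/-- The tensor product of two families of subspaces indexed by degree: its term of degree `n` is
`∑ V p ⊗ W q` over `p + q = n`. -/
def tensorFiltration (V : ℕ → Submodule K M) (W : ℕ → Submodule K N) (n : ℕ) :
    Submodule K (M ⊗[K] N) :=
  ⨆ pq ∈ Finset.HasAntidiagonal.antidiagonal n,
    LinearMap.range (TensorProduct.mapIncl (V pq.1) (W pq.2))

theorem tensorFiltration_le_iff {n : ℕ} {P : Submodule K (M ⊗[K] N)} :
    tensorFiltration V W n ≤ P ↔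
      ∀ p q, p + q = n → ∀ x ∈ V p, ∀ y ∈ W q, x ⊗ₜ[K] y ∈ P := by
  simp only [tensorFiltration, iSup_le_iff, TensorProduct.range_mapIncl, Submodule.map₂_le,
    Finset.HasAntidiagonal.mem_antidiagonal, Prod.forall, TensorProduct.mk_apply]

theorem tmul_mem_tensorFiltration {p q : ℕ} {x : M} {y : N} (hx : x ∈ V p) (hy : y ∈ W q) :
    x ⊗ₜ[K] y ∈ tensorFiltration V W (p + q) :=
  tensorFiltration_le_iff.1 le_rfl p q rfl x hx y hy

theorem iSup_tensorFiltration (hV : ⨆ n, V n = ⊤) (hW : ⨆ n, W n = ⊤) :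
    ⨆ n, tensorFiltration V W n = ⊤ := by
  have hmem : ∀ {p q} {x : M} {y : N}, x ∈ V p → y ∈ W q →
      x ⊗ₜ[K] y ∈ ⨆ n, tensorFiltration V W n := fun hx hy =>
    Submodule.mem_iSup_of_mem _ (tmul_mem_tensorFiltration hx hy)
  rw [eq_top_iff, ← TensorProduct.span_tmul_eq_top, Submodule.span_le]
  rintro _ ⟨x, y, rfl⟩
  induction (hV ▸ Submodule.mem_top : x ∈ ⨆ n, V n) using Submodule.iSup_induction' with
  | zero => rw [TensorProduct.zero_tmul]; exact Submodule.zero_mem _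
  | add x x' _ _ h h' => rw [TensorProduct.add_tmul]; exact Submodule.add_mem _ h h'
  | mem p x hx =>
    induction (hW ▸ Submodule.mem_top : y ∈ ⨆ n, W n) using Submodule.iSup_induction' with
    | zero => rw [TensorProduct.tmul_zero]; exact Submodule.zero_mem _
    | add y y' _ _ h h' => rw [TensorProduct.tmul_add]; exact Submodule.add_mem _ h h'
    | mem q y hy => exact hmem hx hy

open TensorProduct.AlgebraTensorModule in
theorem tensorTensorTensorComm_mem {M' N' : Type*} [AddCommMonoid M'] [Module K M']
    [AddCommMonoid N'] [Module K N'] {V' : ℕ → Submodule K M'} {W' : ℕ → Submodule K N'} {p q : ℕ}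
    {s : M ⊗[K] N} {t : M' ⊗[K] N'} (hs : s ∈ tensorFiltration V W p)
    (ht : t ∈ tensorFiltration V' W' q) :
    tensorTensorTensorComm K K K K M N M' N' (s ⊗ₜ[K] t) ∈
      tensorFiltration (tensorFiltration V V') (tensorFiltration W W') (p + q) := by
  let T := tensorFiltration (tensorFiltration V V') (tensorFiltration W W') (p + q)
  let σ := (tensorTensorTensorComm K K K K M N M' N').toLinearMap
  refine tensorFiltration_le_iff (P := T.comap (σ ∘ₗ (TensorProduct.mk K _ _).flip t)).2
    (fun a b hab x hx y hy => ?_) hs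
  refine tensorFiltration_le_iff (P := T.comap (σ ∘ₗ TensorProduct.mk K _ _ (x ⊗ₜ[K] y))).2
    (fun c d hcd x' hx' y' hy' => ?_) ht
  have hdeg : a + c + (b + d) = p + q := by omega
  simp only [T, ← hdeg]
  exact tmul_mem_tensorFiltration (tmul_mem_tensorFiltration hx hx')
    (tmul_mem_tensorFiltration hy hy')

end TensorFiltration

section Convolution

variable {K H A : Type*} [Field K] [CommRing H] [Bialgebra K H] [CommRing A] [Algebra K A]

theorem ConvHom.sub_apply (f g : ConvHom K H A) (x : H) : (f - g) x = f x - g x := rfl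

theorem postComp_apply (R : A →ₗ[K] A) (f : ConvHom K H A) (x : H) :
    postComp H R f x = R (f x) := rfl

/-- The linear map `x ⊗ y ↦ f x * g y`. -/
def tensorHom (f g : ConvHom K H A) : ConvHom K (H ⊗[K] H) A :=
  WithConv.toConv (LinearMap.mul' K A ∘ₗ TensorProduct.map f.ofConv g.ofConv)

theorem tensorHom_tmul (f g : ConvHom K H A) (x y : H) :
    tensorHom f g (x ⊗ₜ[K] y) = f x * g y := by
  simp [tensorHom]

theorem convMul_apply_eq_tensorHom (f g : ConvHom K H A) (x : H) :
    (f * g) x = tensorHom f g (Coalgebra.comul x) := rfl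

/-- A family of subspaces that spans `H` and satisfies `Δ(G n) ⊆ ∑ G p ⊗ G q` over `p + q = n`.
Both the homogeneous components of a coalgebra grading and the terms of an exhaustive increasing
coalgebra filtration are of this kind. -/
structure IsCoalgebraFiltration (G : ℕ → Submodule K H) : Prop where
  iSup_eq_top : ⨆ n, G n = ⊤
  comul_mem : ∀ n, ∀ x ∈ G n, (Coalgebra.comul x : H ⊗[K] H) ∈ tensorFiltration G G n

section Filtration

variable {G : ℕ → Submodule K H}

theorem tensorHom_mem {m n : ℕ} {f g : ConvHom K H A} (hf : f ∈ homFil A G m)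
    (hg : g ∈ homFil A G n) : tensorHom f g ∈ homFil A (tensorFiltration G G) (m + n) := by
  intro k hk
  refine tensorFiltration_le_iff (P := LinearMap.ker (tensorHom f g).ofConv).2
    fun p q hpq x hx y hy => ?_
  rw [LinearMap.mem_ker, tensorHom_tmul]
  obtain hp | hq : p < m ∨ q < n := by omega
  · rw [hf p hp x hx, zero_mul]
  · rw [hg q hq y hy, mul_zero]

theorem postComp_mem_homFil (R : A →ₗ[K] A) (n : ℕ) (f : ConvHom K H A) (hf : f ∈ homFil A G n) :
    postComp H R f ∈ homFil A G n := by
  intro k hk x hx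
  rw [postComp_apply, hf k hk x hx, map_zero]

variable (A) in
theorem exists_homFil_apply_eq_zero (hG : ⨆ n, G n = ⊤) (x : H) :
    ∃ n, ∀ f ∈ homFil A G n, f x = 0 := by
  have hanti : ∀ {m n}, m ≤ n → homFil A G n ≤ homFil A G m := fun hmn f hf k hk =>
    hf k (hk.trans_le hmn)
  induction (hG ▸ Submodule.mem_top : x ∈ ⨆ n, G n) using Submodule.iSup_induction' with
  | mem n x hx => exact ⟨n + 1, fun f hf => hf n n.lt_succ_self x hx⟩
  | zero => exact ⟨0, fun f _ => map_zero f.ofConv⟩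
  | add x y _ _ hx hy =>
    obtain ⟨m, hm⟩ := hx
    obtain ⟨n, hn⟩ := hy
    exact ⟨max m n, fun f hf => by
      rw [map_add, hm f (hanti (le_max_left m n) hf), hn f (hanti (le_max_right m n) hf),
        add_zero]⟩

theorem homFil_complete (hG : ⨆ n, G n = ⊤) (u : ℕ → ConvHom K H A)
    (hu : ∀ n, ∃ N, ∀ p ≥ N, ∀ q ≥ N, u p - u q ∈ homFil A G n) :
    ∃ L, ∀ n, ∃ N, ∀ p ≥ N, u p - L ∈ homFil A G n := by
  have hconst : ∀ x, ∃ N, ∀ p ≥ N, ∀ q ≥ N, u p x = u q x := fun x => by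
    obtain ⟨n, hn⟩ := exists_homFil_apply_eq_zero A hG x
    obtain ⟨N, hN⟩ := hu n
    exact ⟨N, fun p hp q hq => sub_eq_zero.1 (hn _ (hN p hp q hq))⟩
  choose N hN using hconst
  let L : H →ₗ[K] A :=
    { toFun := fun x => u (N x) x
      map_add' := fun x y => by
        have h := map_add (u (max (N (x + y)) (max (N x) (N y)))).ofConv x y
        rwa [hN (x + y) _ (by simp) (N (x + y)) le_rfl, hN x _ (by simp) (N x) le_rfl,
          hN y _ (by simp) (N y) le_rfl] at h
      map_smul' := fun c x => by
        have h := map_smul (u (max (N (c • x)) (N x))).ofConv c x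
        rwa [hN (c • x) _ (by simp) (N (c • x)) le_rfl, hN x _ (by simp) (N x) le_rfl] at h }
  refine ⟨WithConv.toConv L, fun n => ?_⟩
  obtain ⟨P, hP⟩ := hu n
  refine ⟨P, fun p hp k hk x hx => ?_⟩
  have h := hP p hp (max P (N x)) (le_max_left _ _) k hk x hx
  rwa [ConvHom.sub_apply, hN x _ (le_max_right P (N x)) (N x) le_rfl] at h

variable (A) in
theorem IsCoalgebraFiltration.isCompleteFiltered_homFil (hG : IsCoalgebraFiltration G) :
    IsCompleteFiltered (homFil A G) where
  zero_eq_top := eq_top_iff.2 fun _ _ k hk => absurd hk k.not_lt_zero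
  antitone n f hf k hk := hf k (by omega)
  mul_mem m n f g hf hg k hk x hx := tensorHom_mem hf hg k hk _ (hG.comul_mem k x hx)
  separated f hf := by
    ext x
    obtain ⟨n, hn⟩ := exists_homFil_apply_eq_zero A hG.iSup_eq_top x
    exact hn f (hf n)
  complete := homFil_complete hG.iSup_eq_top

theorem IsFilLimit.exists_apply_eq (hG : ⨆ n, G n = ⊤) {u : ℕ → ConvHom K H A}
    {L : ConvHom K H A} (h : IsFilLimit (homFil A G) u L) (x : H) :
    ∃ N, ∀ p ≥ N, u p x = L x := by
  obtain ⟨n, hn⟩ := exists_homFil_apply_eq_zero A hG x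
  obtain ⟨N, hN⟩ := h n
  exact ⟨N, fun p hp => sub_eq_zero.1 (hn _ (hN p hp))⟩

theorem IsCoalgebraFiltration.tensor (hG : IsCoalgebraFiltration G) :
    IsCoalgebraFiltration (tensorFiltration G G) where
  iSup_eq_top := iSup_tensorFiltration hG.iSup_eq_top hG.iSup_eq_top
  comul_mem n := by
    refine tensorFiltration_le_iff (P := (tensorFiltration (tensorFiltration G G)
      (tensorFiltration G G) n).comap Coalgebra.comul).2 fun p q hpq x hx y hy => ?_
    rw [Submodule.mem_comap, TensorProduct.comul_tmul, ← hpq]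
    exact tensorTensorTensorComm_mem (hG.comul_mem p x hx) (hG.comul_mem q y hy)

end Filtration

theorem isRotaBaxter_postComp {θ : K} {R : A →ₗ[K] A} (hR : IsRotaBaxter θ R) :
    IsRotaBaxter θ (postComp H R) := by
  intro f g
  ext x
  have 𝓡 := Coalgebra.Repr.arbitrary K x
  simp only [postComp_apply, WithConv.ofConv_add, WithConv.ofConv_sub, WithConv.ofConv_smul,
    LinearMap.add_apply, LinearMap.sub_apply, LinearMap.smul_apply, 𝓡.convMul_apply,
    Finset.smul_sum, ← Finset.sum_add_distrib, ← Finset.sum_sub_distrib, map_sum]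
  exact Finset.sum_congr rfl fun i _ => hR _ _

theorem IsCoalgebraFiltration.isCompleteFilteredRotaBaxter_postComp {G : ℕ → Submodule K H}
    (hG : IsCoalgebraFiltration G) {θ : K} {R : A →ₗ[K] A} (hR : IsRotaBaxter θ R) :
    IsCompleteFilteredRotaBaxter θ (homFil A G) (postComp H R) where
  completeFiltered := hG.isCompleteFiltered_homFil A
  rotaBaxter := isRotaBaxter_postComp hR
  map_mem := postComp_mem_homFil R

end Convolution

/-! ### Characters and infinitesimal characters -/

section Characters

variable {K H A : Type*} [Field K] [CommRing H] [Bialgebra K H] [CommRing A] [Algebra K A]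

theorem tensorHom_mul (f g f' g' : ConvHom K H A) :
    tensorHom f g * tensorHom f' g' = tensorHom (f * f') (g * g') := by
  have h := LinearMap.algHom_comp_convMul_distrib (R := K) (Algebra.TensorProduct.lmul' K (S := A))
    (WithConv.toConv (TensorProduct.map f.ofConv g.ofConv))
    (WithConv.toConv (TensorProduct.map f'.ofConv g'.ofConv))
  rw [TensorProduct.map_convMul_map] at h
  exact WithConv.ofConv_injective h.symm

theorem tensorHom_one_one : tensorHom (1 : ConvHom K H A) 1 = 1 := by
  ext x y
  simp [tensorHom, mul_comm]

variable (K H A) in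
/-- The pullback `f ↦ f ∘ (id ⊗ ε)` from the convolution algebra of `H` to that of `H ⊗ H`. -/
def leftPullback : ConvHom K H A →ₐ[K] ConvHom K (H ⊗[K] H) A :=
  AlgHom.ofLinearMap
    { toFun := fun f => tensorHom f 1
      map_add' := fun f g => by ext x y; simp [tensorHom_tmul, add_mul]
      map_smul' := fun c f => by ext x y; simp [tensorHom_tmul] }
    tensorHom_one_one fun f g => by simp [tensorHom_mul]

variable (K H A) in
/-- The pullback `f ↦ f ∘ (ε ⊗ id)` from the convolution algebra of `H` to that of `H ⊗ H`. -/
def rightPullback : ConvHom K H A →ₐ[K] ConvHom K (H ⊗[K] H) A :=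
  AlgHom.ofLinearMap
    { toFun := fun f => tensorHom 1 f
      map_add' := fun f g => by ext x y; simp [tensorHom_tmul, mul_add]
      map_smul' := fun c f => by ext x y; simp [tensorHom_tmul] }
    tensorHom_one_one fun f g => by simp [tensorHom_mul]

variable (K H A) in
/-- The pullback of linear maps along the multiplication of `H`, which is a morphism of
coalgebras. -/
def mulPullback : ConvHom K H A →ₐ[K] ConvHom K (H ⊗[K] H) A :=
  AlgHom.ofLinearMap
    { toFun := fun f => WithConv.toConv (f.ofConv ∘ₗ LinearMap.mul' K H)
      map_add' := fun _ _ => rfl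
      map_smul' := fun _ _ => rfl }
    (by
      ext x y
      change algebraMap K A (Coalgebra.counit (x * y)) = _
      simp [mul_comm])
    fun f g => WithConv.ofConv_injective
      (LinearMap.convMul_comp_coalgHom_distrib f g (Bialgebra.mulCoalgHom K H))

theorem leftPullback_mul_rightPullback (f g : ConvHom K H A) :
    leftPullback K H A f * rightPullback K H A g = tensorHom f g := by
  refine (tensorHom_mul f 1 1 g).trans ?_
  rw [mul_one, one_mul]

theorem commute_leftPullback_rightPullback (f g : ConvHom K H A) :
    Commute (leftPullback K H A f) (rightPullback K H A g) := by
  refine (leftPullback_mul_rightPullback f g).trans (Eq.symm ((tensorHom_mul 1 g f 1).trans ?_))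
  rw [mul_one, one_mul]

theorem isCharacter_iff {f : ConvHom K H A} :
    IsCharacter f ↔
      f 1 = 1 ∧ mulPullback K H A f = leftPullback K H A f * rightPullback K H A f := by
  rw [leftPullback_mul_rightPullback]
  refine and_congr_right fun _ => ⟨fun h => ?_, fun h x y => ?_⟩
  · ext x y
    exact (h x y).trans (tensorHom_tmul f f x y).symm
  · exact (congrArg (fun g : ConvHom K (H ⊗[K] H) A => g (x ⊗ₜ y)) h).trans (tensorHom_tmul f f x y)

theorem isInfinitesimalCharacter_iff {f : ConvHom K H A} :
    IsInfinitesimalCharacter f ↔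
      mulPullback K H A f = leftPullback K H A f + rightPullback K H A f := by
  have happly : ∀ x y, (leftPullback K H A f + rightPullback K H A f) (x ⊗ₜ[K] y) =
      algebraMap K A (Coalgebra.counit x) * f y + f x * algebraMap K A (Coalgebra.counit y) :=
    fun x y => (add_comm _ _).trans
      (congrArg₂ (· + ·) (tensorHom_tmul 1 f x y) (tensorHom_tmul f 1 x y))
  refine ⟨fun h => ?_, fun h x y => ?_⟩
  · ext x y
    exact (h x y).trans (happly x y).symm
  · exact (congrArg (fun g : ConvHom K (H ⊗[K] H) A => g (x ⊗ₜ y)) h).trans (happly x y)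

theorem IsCharacter.mul {f g : ConvHom K H A} (hf : IsCharacter f) (hg : IsCharacter g) :
    IsCharacter (f * g) := by
  rw [isCharacter_iff] at *
  refine ⟨by simp [Algebra.TensorProduct.one_def, hf.1, hg.1], ?_⟩
  rw [map_mul, map_mul, map_mul, hf.2, hg.2]
  exact (commute_leftPullback_rightPullback g f).symm.mul_mul_mul_comm _ _

theorem IsInfinitesimalCharacter.sub {f g : ConvHom K H A} (hf : IsInfinitesimalCharacter f)
    (hg : IsInfinitesimalCharacter g) : IsInfinitesimalCharacter (f - g) := by
  rw [isInfinitesimalCharacter_iff] at *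
  rw [map_sub, map_sub, map_sub, hf, hg, add_sub_add_comm]

theorem IsInfinitesimalCharacter.neg {f : ConvHom K H A} (hf : IsInfinitesimalCharacter f) :
    IsInfinitesimalCharacter (-f) := by
  rw [isInfinitesimalCharacter_iff] at *
  rw [map_neg, map_neg, map_neg, hf, neg_add]

theorem IsInfinitesimalCharacter.postComp {f : ConvHom K H A} (hf : IsInfinitesimalCharacter f)
    (R : A →ₗ[K] A) : IsInfinitesimalCharacter (postComp H R f) := by
  intro x y
  simp only [postComp_apply, hf x y, map_add, mul_comm _ (algebraMap K A _), ← Algebra.smul_def,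
    map_smul]

/-- A connected filtered bialgebra: a coalgebra filtration that is multiplicative, with scalars in
degree zero. -/
structure IsConnectedFilteredBialgebra (G : ℕ → Submodule K H) : Prop
    extends IsCoalgebraFiltration G where
  mul_mem : ∀ {p q x y}, x ∈ G p → y ∈ G q → x * y ∈ G (p + q)
  zero_eq_one : G 0 = 1

theorem IsConnectedGradedBialgebra.isConnectedFilteredBialgebra {G : ℕ → Submodule K H}
    [GradedAlgebra G] (hG : IsConnectedGradedBialgebra G) : IsConnectedFilteredBialgebra G where
  iSup_eq_top := (DirectSum.Decomposition.isInternal G).submodule_iSup_eq_top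
  comul_mem := hG.comul_mem
  mul_mem hx hy := SetLike.mul_mem_graded hx hy
  zero_eq_one := hG.connected

variable {G : ℕ → Submodule K H}

theorem leftPullback_mem (n : ℕ) (f : ConvHom K H A) (hf : f ∈ homFil A G n) :
    leftPullback K H A f ∈ homFil A (tensorFiltration G G) n :=
  tensorHom_mem (n := 0) hf fun _ hk => absurd hk (Nat.not_lt_zero _)

theorem rightPullback_mem (n : ℕ) (f : ConvHom K H A) (hf : f ∈ homFil A G n) :
    rightPullback K H A f ∈ homFil A (tensorFiltration G G) n :=
  zero_add n ▸ tensorHom_mem (m := 0) (fun _ hk => absurd hk (Nat.not_lt_zero _)) hf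

theorem IsCoalgebraFiltration.isInfinitesimalCharacter_of_isFilLimit (hG : IsCoalgebraFiltration G)
    {u : ℕ → ConvHom K H A} {L : ConvHom K H A} (hu : ∀ n, IsInfinitesimalCharacter (u n))
    (h : IsFilLimit (homFil A G) u L) : IsInfinitesimalCharacter L := by
  intro x y
  obtain ⟨M, hM⟩ := h.exists_apply_eq hG.iSup_eq_top x
  obtain ⟨N, hN⟩ := h.exists_apply_eq hG.iSup_eq_top y
  obtain ⟨P, hP⟩ := h.exists_apply_eq hG.iSup_eq_top (x * y)
  rw [← hM (M + N + P) (by omega), ← hN (M + N + P) (by omega), ← hP (M + N + P) (by omega)]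
  exact hu _ x y

namespace IsConnectedFilteredBialgebra

variable (hG : IsConnectedFilteredBialgebra G)
include hG

theorem mulPullback_mem (n : ℕ) (f : ConvHom K H A) (hf : f ∈ homFil A G n) :
    mulPullback K H A f ∈ homFil A (tensorFiltration G G) n := fun k hk =>
  tensorFiltration_le_iff (P := LinearMap.ker (mulPullback K H A f).ofConv).2
    fun _ _ hpq x hx y hy => hf k hk (x * y) (hpq ▸ hG.mul_mem hx hy)

theorem mem_homFil_one_iff {f : ConvHom K H A} : f ∈ homFil A G 1 ↔ f 1 = 0 := by
  refine ⟨fun hf => hf 0 one_pos 1 (hG.zero_eq_one ▸ Submodule.one_le.1 le_rfl),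
    fun hf k hk x hx => ?_⟩
  obtain rfl : k = 0 := Nat.lt_one_iff.1 hk
  rw [hG.zero_eq_one, Submodule.mem_one] at hx
  obtain ⟨c, rfl⟩ := hx
  rw [Algebra.algebraMap_eq_smul_one, map_smul, hf, smul_zero]

theorem sub_one_mem_homFil_one_iff {f : ConvHom K H A} : f - 1 ∈ homFil A G 1 ↔ f 1 = 1 := by
  rw [hG.mem_homFil_one_iff, ConvHom.sub_apply, sub_eq_zero]
  simp

theorem sub_one_mem_homFil_one {φ : ConvHom K H A} (hφ : IsCharacter φ) : φ - 1 ∈ homFil A G 1 :=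
  hG.sub_one_mem_homFil_one_iff.2 hφ.1

variable [CharZero K]

/-- On `H ⊗ H`, exponentiation turns the Leibniz rule
`mulPullback Z = leftPullback Z + rightPullback Z` into multiplicativity of `exp Z`, since the two
summands commute. -/
theorem isCharacter_filExp_iff {Z : ConvHom K H A} (hZ : Z ∈ homFil A G 1) :
    IsCharacter (filExp (homFil A G) Z) ↔ IsInfinitesimalCharacter Z := by
  have hF := hG.isCompleteFiltered_homFil A
  have hF₂ := hG.tensor.isCompleteFiltered_homFil A
  have hL := leftPullback_mem (A := A) 1 Z hZ
  have hR := rightPullback_mem (A := A) 1 Z hZ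
  rw [isCharacter_iff, isInfinitesimalCharacter_iff,
    and_iff_right (hG.sub_one_mem_homFil_one_iff.1 (hF.filExp_sub_one_mem hZ)),
    hF.map_filExp hF₂ hG.mulPullback_mem hZ, hF.map_filExp hF₂ leftPullback_mem hZ,
    hF.map_filExp hF₂ rightPullback_mem hZ,
    ← hF₂.filExp_add_of_commute hL hR (commute_leftPullback_rightPullback Z Z),
    hF₂.filExp_injOn.eq_iff (hG.mulPullback_mem 1 Z hZ) (Submodule.add_mem _ hL hR)]

theorem isInfinitesimalCharacter_filLog {φ : ConvHom K H A} (hφ : IsCharacter φ) :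
    IsInfinitesimalCharacter (filLog (homFil A G) φ) := by
  have hF := hG.isCompleteFiltered_homFil A
  have hφ₁ := hG.sub_one_mem_homFil_one hφ
  rwa [← hG.isCharacter_filExp_iff (hF.filLog_mem hφ₁), hF.filExp_filLog hφ₁]

theorem isInfinitesimalCharacter_filBCH {X Y : ConvHom K H A} (hX : X ∈ homFil A G 1)
    (hY : Y ∈ homFil A G 1) (hX' : IsInfinitesimalCharacter X)
    (hY' : IsInfinitesimalCharacter Y) :
    IsInfinitesimalCharacter (filBCH (homFil A G) X Y) :=
  ((hG.isInfinitesimalCharacter_filLog (((hG.isCharacter_filExp_iff hX).2 hX').mul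
    ((hG.isCharacter_filExp_iff hY).2 hY'))).sub hX').sub hY'

theorem isInfinitesimalCharacter_chi (R : A →ₗ[K] A) {b : ConvHom K H A}
    (hb : b ∈ homFil A G 1) (hb' : IsInfinitesimalCharacter b) :
    IsInfinitesimalCharacter (chi (homFil A G) (postComp H R) b) := by
  have hF := hG.isCompleteFiltered_homFil A
  refine hG.isInfinitesimalCharacter_of_isFilLimit (fun n => ?_)
    (hF.isFilLimit_chi (postComp_mem_homFil R) hb)
  have hstep : Set.MapsTo (chiStep (homFil A G) (postComp H R) b)
      {x | x ∈ homFil A G 1 ∧ IsInfinitesimalCharacter x}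
      {x | x ∈ homFil A G 1 ∧ IsInfinitesimalCharacter x} := fun x ⟨hx, hx'⟩ =>
    ⟨(hF.isFilContraction_chiStep (postComp_mem_homFil R) hb).mapsTo hx,
      hb'.sub (hG.isInfinitesimalCharacter_filBCH (postComp_mem_homFil R 1 x hx)
        ((homFil A G 1).sub_mem hx (postComp_mem_homFil R 1 x hx)) (hx'.postComp R)
        (hx'.sub (hx'.postComp R)))⟩
  rw [chiApprox_eq_iterate]
  exact (hstep.iterate n ⟨hb, hb'⟩).2

end IsConnectedFilteredBialgebra

end Characters

/-! ### Bogoliubov's preparation map -/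

section BarMap

variable {K H A : Type*} [Field K] [CommRing H] [Bialgebra K H] [CommRing A] [Algebra K A]

theorem barMap_apply (ψ φ : ConvHom K H A) (x : H) :
    barMap ψ φ x = φ x + tensorHom ψ φ (reducedComul K H x) := rfl

theorem barMap_eq_mul_sub_one {ψ φ : ConvHom K H A} (hψ : ψ 1 = 1) (hφ : φ 1 = 1) :
    barMap ψ φ = ψ * (φ - 1) := by
  ext x
  have hred : reducedComul K H x = Coalgebra.comul x - x ⊗ₜ[K] 1 - 1 ⊗ₜ[K] x := rfl
  rw [mul_sub, mul_one, ConvHom.sub_apply, convMul_apply_eq_tensorHom, barMap_apply, hred,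
    map_sub, map_sub, tensorHom_tmul, tensorHom_tmul, hψ, hφ]
  ring

theorem barMap_apply_of_comul_eq (ψ φ : ConvHom K H A) {ι : Type*} {s : Finset ι} {γ ρ : ι → H}
    {x : H} (h : (Coalgebra.comul x : H ⊗[K] H) = x ⊗ₜ[K] 1 + 1 ⊗ₜ[K] x
      + ∑ i ∈ s, γ i ⊗ₜ[K] ρ i) :
    barMap ψ φ x = φ x + ∑ i ∈ s, ψ (γ i) * φ (ρ i) := by
  have hred : reducedComul K H x = ∑ i ∈ s, γ i ⊗ₜ[K] ρ i := by
    change Coalgebra.comul x - x ⊗ₜ[K] 1 - 1 ⊗ₜ[K] x = _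
    rw [h, add_assoc, add_sub_cancel_left, add_sub_cancel_left]
  simp only [barMap_apply, hred, map_sum, tensorHom_tmul]

theorem postComp_postComp {R : A →ₗ[K] A} (hR : ∀ x, R (R x) = R x) (f : ConvHom K H A) :
    postComp H R (postComp H R f) = postComp H R f :=
  WithConv.ofConv_injective (LinearMap.ext fun x => hR (f x))

theorem postComp_one_apply (R : A →ₗ[K] A) (x : H) :
    postComp H R 1 x = Coalgebra.counit (R := K) x • R 1 := by
  rw [postComp_apply, LinearMap.convOne_apply, Algebra.algebraMap_eq_smul_one, map_smul]

namespace IsConnectedFilteredBialgebra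

variable [CharZero K] {G : ℕ → Submodule K H} (hG : IsConnectedFilteredBialgebra G)
  {φ : ConvHom K H A} (hφ : IsCharacter φ)
include hG hφ

theorem isInfinitesimalCharacter_chi_filLog (R : A →ₗ[K] A) :
    IsInfinitesimalCharacter (chi (homFil A G) (postComp H R) (filLog (homFil A G) φ)) :=
  hG.isInfinitesimalCharacter_chi R
    ((hG.isCompleteFiltered_homFil A).filLog_mem (hG.sub_one_mem_homFil_one hφ))
    (hG.isInfinitesimalCharacter_filLog hφ)

variable {R : A →ₗ[K] A} (hR : IsRotaBaxter (1 : K) R)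
include hR

theorem isCharacter_birkhoffMinus :
    IsCharacter (birkhoffMinus (homFil A G) (postComp H R) φ) := by
  have hB := hG.isCompleteFilteredRotaBaxter_postComp hR
  have hc := hB.chi_filLog_mem (hG.sub_one_mem_homFil_one hφ)
  exact (hG.isCharacter_filExp_iff (neg_mem (hB.map_mem 1 _ hc))).2
    ((hG.isInfinitesimalCharacter_chi_filLog hφ R).postComp R).neg

theorem isCharacter_birkhoffPlus :
    IsCharacter (birkhoffPlus (homFil A G) (postComp H R) φ) := by
  have hB := hG.isCompleteFilteredRotaBaxter_postComp hR
  have hc := hB.chi_filLog_mem (hG.sub_one_mem_homFil_one hφ)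
  have hinf := hG.isInfinitesimalCharacter_chi_filLog hφ R
  exact (hG.isCharacter_filExp_iff (hB.sub_map_mem hc)).2 (hinf.sub (hinf.postComp R))

theorem isCharacter_inverse_birkhoffPlus :
    IsCharacter (Ring.inverse (birkhoffPlus (homFil A G) (postComp H R) φ)) := by
  have hB := hG.isCompleteFilteredRotaBaxter_postComp hR
  have hφ₁ := hG.sub_one_mem_homFil_one hφ
  have hinf := hG.isInfinitesimalCharacter_chi_filLog hφ R
  rw [hB.inverse_birkhoffPlus hφ₁]
  exact (hG.isCharacter_filExp_iff (neg_mem (hB.sub_map_mem (hB.chi_filLog_mem hφ₁)))).2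
    (hinf.sub (hinf.postComp R)).neg

theorem barMap_birkhoffMinus :
    barMap (birkhoffMinus (homFil A G) (postComp H R) φ) φ
      = birkhoffMinus (homFil A G) (postComp H R) φ * (φ - 1) :=
  barMap_eq_mul_sub_one (hG.isCharacter_birkhoffMinus hφ hR).1 hφ.1

theorem birkhoff_apply_eq_barMap {x : H} (hx : Coalgebra.counit (R := K) x = 0) :
    birkhoffMinus (homFil A G) (postComp H R) φ x
        = -R (barMap (birkhoffMinus (homFil A G) (postComp H R) φ) φ x) ∧
      birkhoffPlus (homFil A G) (postComp H R) φ x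
        = (LinearMap.id - R : A →ₗ[K] A)
          (barMap (birkhoffMinus (homFil A G) (postComp H R) φ) φ x) := by
  have hB := hG.isCompleteFilteredRotaBaxter_postComp hR
  have hφ₁ := hG.sub_one_mem_homFil_one hφ
  have hone : (1 : ConvHom K H A) x = 0 := by rw [LinearMap.convOne_apply, hx, map_zero]
  rw [hG.barMap_birkhoffMinus hφ hR]
  constructor
  · have h := congrArg (fun f : ConvHom K H A => f x) (hB.map_birkhoffMinus_mul_sub_one hφ₁)
    simp only [postComp_apply, ConvHom.sub_apply, hone] at h
    rw [h, zero_sub, neg_neg]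
  · have h := congrArg (fun f : ConvHom K H A => f x)
      (hB.id_sub_map_birkhoffMinus_mul_sub_one hφ₁)
    simp only [ConvHom.sub_apply, hone] at h
    rw [← sub_zero (birkhoffPlus _ _ φ x), ← h]
    rfl

theorem barMap_birkhoffMinus_apply {x : H} (hx : Coalgebra.counit (R := K) x = 0) :
    barMap (birkhoffMinus (homFil A G) (postComp H R) φ) φ x
      = -doubleExp (homFil A G) (postComp H R)
          (-chi (homFil A G) (postComp H R) (filLog (homFil A G) φ)) x := by
  have hB := hG.isCompleteFilteredRotaBaxter_postComp hR
  rw [hG.barMap_birkhoffMinus hφ hR, hB.birkhoffMinus_mul_sub_one (hG.sub_one_mem_homFil_one hφ),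
    ConvHom.sub_apply, LinearMap.convOne_apply, hx, map_zero, zero_sub]

theorem postComp_doubleExp_neg_chi_apply {x : H} (hx : Coalgebra.counit (R := K) x • R 1 = 0) :
    postComp H R (doubleExp (homFil A G) (postComp H R)
        (-chi (homFil A G) (postComp H R) (filLog (homFil A G) φ))) x
      = (birkhoffMinus (homFil A G) (postComp H R) φ - 1) x := by
  have hB := hG.isCompleteFilteredRotaBaxter_postComp hR
  rw [hB.map_doubleExp_neg_chi (hG.sub_one_mem_homFil_one hφ), WithConv.ofConv_add,
    LinearMap.add_apply, postComp_one_apply, hx, zero_add]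

theorem id_sub_postComp_doubleExp_neg_chi_apply {x : H}
    (hx : Coalgebra.counit (R := K) x • R 1 = 0) :
    (LinearMap.id - postComp H R : ConvHom K H A →ₗ[K] ConvHom K H A)
        (doubleExp (homFil A G) (postComp H R)
          (-chi (homFil A G) (postComp H R) (filLog (homFil A G) φ))) x
      = (2 - birkhoffPlus (homFil A G) (postComp H R) φ) x := by
  have hB := hG.isCompleteFilteredRotaBaxter_postComp hR
  rw [hB.id_sub_map_doubleExp_neg_chi (hG.sub_one_mem_homFil_one hφ), ConvHom.sub_apply,
    postComp_one_apply, hx, sub_zero]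

end IsConnectedFilteredBialgebra

end BarMap

end RotaBaxterRenorm

end

open RotaBaxterRenorm in
theorem theorem4p1_general {K H A : Type*} [Field K] [CharZero K]
    [CommRing H] [Bialgebra K H] (G : ℕ → Submodule K H)
    (hG : IsConnectedFilteredBialgebra G)
    [CommRing A] [Algebra K A] (R : A →ₗ[K] A)
    (hRB : IsRotaBaxter (1 : K) R) (hR : ∀ x, R (R x) = R x)
    (Rt : A →ₗ[K] A) (hRt : Rt = LinearMap.id - R)
    (F : ℕ → Submodule K (ConvHom K H A)) (hF : F = homFil A G)
    (cR : ConvHom K H A →ₗ[K] ConvHom K H A) (hcR : cR = postComp H R)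
    (cRt : ConvHom K H A →ₗ[K] ConvHom K H A) (hcRt : cRt = LinearMap.id - cR) :
    IsCompleteFilteredRotaBaxter (1 : K) F cR ∧ (∀ f, cR (cR f) = cR f) ∧
    ∀ φ a b c : ConvHom K H A, IsCharacter φ →
      a = φ - 1 → b = filLog F φ → c = chi F cR b →
      a ∈ F 1 ∧ IsUnit φ ∧
      (b ∈ F 1 ∧ IsInfinitesimalCharacter b ∧ filExp F b = φ ∧
        ∀ b' ∈ F 1, filExp F b' = φ → b' = b) ∧
      (c ∈ F 1 ∧ IsFilLimit F (chiApprox F cR b) c ∧ c = b - filBCH F (cR c) (cRt c)) ∧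
      ∃ φm φp Y : ConvHom K H A,
        ((φm = 1 - cR (φm * a) ∧ ∀ X, X = 1 - cR (X * a) → X = φm) ∧
          (Y = 1 - cRt (a * Y) ∧ ∀ Y', Y' = 1 - cRt (a * Y') → Y' = Y) ∧
          Y * φp = 1 ∧ φp * Y = 1 ∧ IsCharacter Y ∧
          φp = 1 - cRt (φp * (Ring.inverse φ - 1)) ∧
          φp = φm * φ ∧
          (∀ Γ : H, Coalgebra.counit (R := K) Γ = 0 →
            φm Γ = -R (barMap φm φ Γ) ∧ φp Γ = Rt (barMap φm φ Γ)) ∧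
          ∀ (ι : Type) (s : Finset ι) (γ ρ : ι → H) (Γ : H),
            Coalgebra.counit (R := K) Γ = 0 →
            (Coalgebra.comul Γ : TensorProduct K H H) =
              TensorProduct.tmul K Γ 1 + TensorProduct.tmul K 1 Γ
                + ∑ i ∈ s, TensorProduct.tmul K (γ i) (ρ i) →
            φm Γ = -R (φ Γ + ∑ i ∈ s, φm (γ i) * φ (ρ i)) ∧
            φp Γ = Rt (φ Γ + ∑ i ∈ s, φm (γ i) * φ (ρ i))) ∧
        (IsFilLimit F (fun N => ∑ n ∈ Finset.range N, (-1) ^ n * leftIter cR a n) φm ∧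
          IsFilLimit F (fun N => ∑ n ∈ Finset.range N, (-1) ^ n * rightIter cRt a n) Y ∧
          φm = filExp F (-cR c) ∧ φp = filExp F (cRt c) ∧ Y = filExp F (-cRt c) ∧
          IsCharacter φm ∧ IsCharacter φp ∧
          φm ∈ oneAddRange F cR ∧ φp ∈ oneAddRange F cRt) ∧
        (IsUnit φm ∧ φ = Ring.inverse φm * φp ∧
          Ring.inverse φm = filExp F (cR c) ∧ φ = filExp F (cR c) * filExp F (cRt c) ∧
          ∀ ψm ∈ oneAddRange F cR, ∀ ψp ∈ oneAddRange F cRt,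
            φ = Ring.inverse ψm * ψp → ψm = φm ∧ ψp = φp) ∧
        (barMap φm φ = φm * (φ - 1) ∧
          barMap φm φ = 1 - doubleExp F cR (-c) ∧
          (∀ Γ : H, Coalgebra.counit (R := K) Γ = 0 →
            barMap φm φ Γ = -(doubleExp F cR (-c) Γ) ∧
            cR (doubleExp F cR (-c)) Γ = (φm - 1) Γ ∧
            cRt (doubleExp F cR (-c)) Γ = (2 - φp) Γ) ∧
          cR (barMap φm φ) = 1 - φm ∧ cRt (barMap φm φ) = φp - 1 ∧
          (R 1 = 0 → cR (doubleExp F cR (-c)) = φm - 1 ∧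
            cRt (doubleExp F cR (-c)) = 2 - φp)) := by
  subst hRt hF hcR hcRt
  have hB := hG.isCompleteFilteredRotaBaxter_postComp hRB
  refine ⟨hB, postComp_postComp hR, ?_⟩
  rintro φ _ _ _ hφ rfl rfl rfl
  have ha := hG.sub_one_mem_homFil_one hφ
  have hb := hB.completeFiltered.filLog_mem ha
  have hbar := hG.barMap_birkhoffMinus hφ hRB
  have happly := fun Γ => hG.birkhoff_apply_eq_barMap hφ hRB (x := Γ)
  have hE := fun Γ => hG.postComp_doubleExp_neg_chi_apply hφ hRB (x := Γ)
  have hE' := fun Γ => hG.id_sub_postComp_doubleExp_neg_chi_apply hφ hRB (x := Γ)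
  refine ⟨ha, hB.completeFiltered.isUnit_of_sub_one_mem ha, ⟨hb,
    hG.isInfinitesimalCharacter_filLog hφ, hB.completeFiltered.filExp_filLog ha,
    fun _ hb' => hB.completeFiltered.eq_filLog hb' ha⟩, ⟨hB.chi_filLog_mem ha,
    hB.completeFiltered.isFilLimit_chi hB.map_mem hb,
    hB.completeFiltered.chi_eq hB.map_mem hb⟩,
    birkhoffMinus (homFil A G) (postComp H R) φ, birkhoffPlus (homFil A G) (postComp H R) φ,
    Ring.inverse (birkhoffPlus (homFil A G) (postComp H R) φ), ?_, ?_, ?_, ?_⟩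
  · exact ⟨⟨hB.birkhoffMinus_eq_one_sub ha, fun _ => hB.eq_birkhoffMinus ha⟩,
      ⟨hB.inverse_birkhoffPlus_eq_one_sub ha, fun _ => hB.eq_inverse_birkhoffPlus ha⟩,
      Ring.inverse_mul_cancel _ (hB.isUnit_birkhoffPlus ha),
      Ring.mul_inverse_cancel _ (hB.isUnit_birkhoffPlus ha),
      hG.isCharacter_inverse_birkhoffPlus hφ hRB, hB.birkhoffPlus_eq_one_sub ha,
      (hB.birkhoffMinus_mul ha).symm, happly,
      fun _ _ _ _ Γ hΓ h => barMap_apply_of_comul_eq _ φ h ▸ happly Γ hΓ⟩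
  · exact ⟨hB.isFilLimit_leftIter_birkhoffMinus ha,
      hB.isFilLimit_rightIter_inverse_birkhoffPlus ha, rfl, rfl, hB.inverse_birkhoffPlus ha,
      hG.isCharacter_birkhoffMinus hφ hRB, hG.isCharacter_birkhoffPlus hφ hRB,
      hB.birkhoffMinus_mem_oneAddRange ha, hB.birkhoffPlus_mem_oneAddRange ha⟩
  · exact ⟨hB.isUnit_birkhoffMinus ha, (hB.inverse_birkhoffMinus_mul ha).symm,
      hB.inverse_birkhoffMinus ha, hB.eq_filExp_mul_filExp_chi ha,
      fun _ hm _ hp => hB.eq_birkhoff_of_eq_inverse_mul ha (postComp_postComp hR) hm hp⟩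
  · refine ⟨hbar, hbar.trans (hB.birkhoffMinus_mul_sub_one ha), fun Γ hΓ =>
      have hΓ' : Coalgebra.counit (R := K) Γ • R 1 = 0 := by rw [hΓ, zero_smul]
      ⟨hG.barMap_birkhoffMinus_apply hφ hRB hΓ, hE Γ hΓ', hE' Γ hΓ'⟩,
      hbar ▸ hB.map_birkhoffMinus_mul_sub_one ha,
      hbar ▸ hB.id_sub_map_birkhoffMinus_mul_sub_one ha, fun hR₁ => ?_⟩
    have hΓ' : ∀ Γ : H, Coalgebra.counit (R := K) Γ • R 1 = 0 := by simp [hR₁]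
    exact ⟨WithConv.ofConv_injective (LinearMap.ext fun Γ => hE Γ (hΓ' Γ)),
      WithConv.ofConv_injective (LinearMap.ext fun Γ => hE' Γ (hΓ' Γ))⟩

open RotaBaxterRenorm in
theorem theorem4p1 {K H A : Type*} [Field K] [CharZero K]
    [CommRing H] [Bialgebra K H] (G : ℕ → Submodule K H) [GradedAlgebra G]
    (hG : IsConnectedGradedBialgebra G)
    [CommRing A] [Algebra K A] (R : A →ₗ[K] A)
    (hRB : IsRotaBaxter (1 : K) R) (hR : ∀ x, R (R x) = R x)
    (Rt : A →ₗ[K] A) (hRt : Rt = LinearMap.id - R)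
    (F : ℕ → Submodule K (ConvHom K H A)) (hF : F = homFil A G)
    (cR : ConvHom K H A →ₗ[K] ConvHom K H A) (hcR : cR = postComp H R)
    (cRt : ConvHom K H A →ₗ[K] ConvHom K H A) (hcRt : cRt = LinearMap.id - cR) :
    -- the complete filtered Rota–Baxter algebra `Hom(H, A)`
    IsCompleteFilteredRotaBaxter (1 : K) F cR ∧ (∀ f, cR (cR f) = cR f) ∧
    ∀ φ a b c : ConvHom K H A, IsCharacter φ →
      a = φ - 1 → b = filLog F φ → c = chi F cR b →
      -- `φ = exp(b)` for a unique `b`, which is an infinitesimal character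
      a ∈ F 1 ∧ IsUnit φ ∧
      (b ∈ F 1 ∧ IsInfinitesimalCharacter b ∧ filExp F b = φ ∧
        ∀ b' ∈ F 1, filExp F b' = φ → b' = b) ∧
      -- the BCH-recursion converges
      (c ∈ F 1 ∧ IsFilLimit F (chiApprox F cR b) c ∧ c = b - filBCH F (cR c) (cRt c)) ∧
      ∃ φm φp Y : ConvHom K H A,
        -- (1) Atkinson's recursions and their solutions
        ((φm = 1 - cR (φm * a) ∧ ∀ X, X = 1 - cR (X * a) → X = φm) ∧
          (Y = 1 - cRt (a * Y) ∧ ∀ Y', Y' = 1 - cRt (a * Y') → Y' = Y) ∧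
          Y * φp = 1 ∧ φp * Y = 1 ∧ IsCharacter Y ∧
          φp = 1 - cRt (φp * (Ring.inverse φ - 1)) ∧
          φp = φm * φ ∧
          (∀ Γ : H, Coalgebra.counit (R := K) Γ = 0 →
            φm Γ = -R (barMap φm φ Γ) ∧ φp Γ = Rt (barMap φm φ Γ)) ∧
          ∀ (ι : Type) (s : Finset ι) (γ ρ : ι → H) (Γ : H),
            Coalgebra.counit (R := K) Γ = 0 →
            (Coalgebra.comul Γ : TensorProduct K H H) =
              TensorProduct.tmul K Γ 1 + TensorProduct.tmul K 1 Γ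
                + ∑ i ∈ s, TensorProduct.tmul K (γ i) (ρ i) →
            φm Γ = -R (φ Γ + ∑ i ∈ s, φm (γ i) * φ (ρ i)) ∧
            φp Γ = Rt (φ Γ + ∑ i ∈ s, φm (γ i) * φ (ρ i))) ∧
        -- (2) Spitzer's identity and the exponential formulae
        (IsFilLimit F (fun N => ∑ n ∈ Finset.range N, (-1) ^ n * leftIter cR a n) φm ∧
          IsFilLimit F (fun N => ∑ n ∈ Finset.range N, (-1) ^ n * rightIter cRt a n) Y ∧
          φm = filExp F (-cR c) ∧ φp = filExp F (cRt c) ∧ Y = filExp F (-cRt c) ∧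
          IsCharacter φm ∧ IsCharacter φp ∧
          φm ∈ oneAddRange F cR ∧ φp ∈ oneAddRange F cRt) ∧
        -- (3) the unique Birkhoff decomposition
        (IsUnit φm ∧ φ = Ring.inverse φm * φp ∧
          Ring.inverse φm = filExp F (cR c) ∧ φ = filExp F (cR c) * filExp F (cRt c) ∧
          ∀ ψm ∈ oneAddRange F cR, ∀ ψp ∈ oneAddRange F cRt,
            φ = Ring.inverse ψm * ψp → ψm = φm ∧ ψp = φp) ∧
        -- (4) Bogoliubov's preparation map
        (barMap φm φ = φm * (φ - 1) ∧
          barMap φm φ = 1 - doubleExp F cR (-c) ∧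
          (∀ Γ : H, Coalgebra.counit (R := K) Γ = 0 →
            barMap φm φ Γ = -(doubleExp F cR (-c) Γ) ∧
            cR (doubleExp F cR (-c)) Γ = (φm - 1) Γ ∧
            cRt (doubleExp F cR (-c)) Γ = (2 - φp) Γ) ∧
          cR (barMap φm φ) = 1 - φm ∧ cRt (barMap φm φ) = φp - 1 ∧
          (R 1 = 0 → cR (doubleExp F cR (-c)) = φm - 1 ∧
            cRt (doubleExp F cR (-c)) = 2 - φp)) :=
  theorem4p1_general G hG.isConnectedFilteredBialgebra R hRB hR Rt hRt F hF cR hcR cRt hcRt
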